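/- All groups are finite. For a group $G$ and a non-negative integer $d$, let $\Gamma_d(G)$ be the graph whose vertices are the elements of $G$, two different vertices $x,y$ being adjacent if there is a generating set of $G$ of cardinality $d$ containing $x$ and $y$; let $\Delta_d(G)$ be the graph obtained from $\Gamma_d(G)$ by removing the isolated vertices. (The empty graph is regarded as connected.) Let $L$ be a monolithic group (a group with exactly one minimal normal subgroup) whose socle $N=\mathrm{soc}(L)$ is non-abelian. For $k\ge 1$ the (non-abelian) crown-based power of $L$ of size $k$ is $$L_k=\{(l_1,\dots,l_k)\in L^k \mid l_1\equiv\cdots\equiv l_k \bmod N\}.$$ For $a\in L$ and $m=(n_1,\dots,n_k)\in N^k$ put $a\circ m=(an_1,\dots,an_k)\in L_k$. Given $a_1,\dots,a_t\in L$ with $\langle a_1,\dots,a_t\rangle=L$, let $\Gamma_{a_1,\dots,a_t}(L_k)$ be the graph with vertex set $\{a_i\circ m\mid 1\le i\le t,\ m\in N^k\}\subseteq L_k$, in which two different vertices are adjacent if they can be written as $a_i\circ m_i$ and $a_j\circ m_j$ with $i\ne j$ such that there exist $m_u\in N^k$ for $u\notin\{i,j\}$ with $L_k=\langle a_1\circ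 m_1,\dots,a_t\circ m_t\rangle$. Let $\Delta_{a_1,\dots,a_t}(L_k)$ be the graph obtained from it by removing the isolated vertices. It is called weakly connected if for every $1\le i\le t$ and any two vertices $a_i\circ m_1$, $a_i\circ m_2$ of $\Delta_{a_1,\dots,a_t}(L_k)$ there is $m\in N^k$ such that $a_i\circ m_1$ and $(a_i\circ m_2)^m$ belong to the same connected component of $\Delta_{a_1,\dots,a_t}(L_k)$. The crown-based power $L_k$ is called $t$-locally connected if $\Delta_{a_1,\dots,a_t}(L_k)$ is weakly connected whenever $\langle a_1,\dots,a_t\rangle=L$. **Lemma.** Let $G$ be a finite group and $d$ a non-negative integer. Suppose that every non-abelian crown-based power $L_k$ ($k\ge 1$, $L$ a finite monolithic group with non-abelian socle) that is an epimorphic image of $G$ is $d$-locally connected. Then $\Delta_d(G)$ is connected. -/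

import Mathlib

universe u

namespace RankGraph

/-! ### Connectivity after removing isolated vertices -/

/-- The graph obtained from `Γ` by removing its isolated vertices. -/
def removeIsolated {V : Type u} (Γ : SimpleGraph V) : SimpleGraph Γ.support :=
  Γ.induce Γ.support

/-- The graph `Γ_d(G)`: the vertices are the elements of `G`, and two different elements are
adjacent if some generating set of `G` of cardinality `d` contains both of them. -/
def generationGraph (G : Type u) [Group G] (d : ℕ) : SimpleGraph G where
  Adj x y := x ≠ y ∧ ∃ S : Finset G,
    S.card = d ∧ x ∈ S ∧ y ∈ S ∧ Subgroup.closure (S : Set G) = ⊤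
  symm := ⟨fun _ _ ⟨hne, S, hS, hx, hy, hgen⟩ => ⟨hne.symm, S, hS, hy, hx, hgen⟩⟩
  loopless := ⟨fun _ h => h.1 rfl⟩

/-- The graph `Δ_d(G)`: remove the isolated vertices from `Γ_d(G)`. -/
def rankGraph (G : Type u) [Group G] (d : ℕ) :
    SimpleGraph (generationGraph G d).support :=
  removeIsolated (generationGraph G d)

/-! ### Monolithic groups and crown-based powers -/

/-- Minimal normal subgroups: minimal among the nontrivial normal subgroups. -/
def IsMinimalNormal {L : Type u} [Group L] (N : Subgroup L) : Prop :=
  Minimal (fun K : Subgroup L => K.Normal ∧ K ≠ ⊥) N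

/-- The socle: the subgroup generated by all minimal normal subgroups. -/
def socle (L : Type u) [Group L] : Subgroup L :=
  sSup {N : Subgroup L | IsMinimalNormal N}

instance socle_normal (L : Type u) [Group L] : (socle L).Normal :=
  Subgroup.sSup_normal _ fun _ (hN : IsMinimalNormal _) => hN.prop.1

/-- A group is monolithic if it has exactly one minimal normal subgroup. -/
def IsMonolithic (L : Type u) [Group L] : Prop :=
  ∃! N : Subgroup L, IsMinimalNormal N

/-- The socle of `L` is non-abelian. -/
def HasNonabelianSocle (L : Type u) [Group L] : Prop :=
  ∃ x ∈ socle L, ∃ y ∈ socle L, x * y ≠ y * x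

/-- The crown-based power `L_k = {(l_1, …, l_k) ∈ L^k | l_1 ≡ ⋯ ≡ l_k mod soc L}`. -/
def crownPower (L : Type u) [Group L] (k : ℕ) : Subgroup (Fin k → L) where
  carrier := {l | ∀ i j, (l i : L ⧸ socle L) = (l j : L ⧸ socle L)}
  one_mem' := fun _ _ => rfl
  mul_mem' := fun {a b} ha hb i j => by
    simp only [Pi.mul_apply, QuotientGroup.mk_mul]
    rw [ha i j, hb i j]
  inv_mem' := fun {a} ha i j => by
    simp only [Pi.inv_apply, QuotientGroup.mk_inv]
    rw [ha i j]

/-- The element `a ∘ m = (a n_1, …, a n_k)` of `L_k`, for `a ∈ L` and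
`m = (n_1, …, n_k) ∈ (soc L)^k`. -/
def circ {L : Type u} [Group L] {k : ℕ} (a : L) (m : Fin k → socle L) : crownPower L k :=
  ⟨fun j => a * (m j : L), fun i j => by
    rw [QuotientGroup.mk_mul_of_mem a (m i).2, QuotientGroup.mk_mul_of_mem a (m j).2]⟩

/-! ### Local connectivity -/

/-- The graph `Γ_{a_1, …, a_t}(L_k)`: two different elements `a_i ∘ m_i` and `a_j ∘ m_j` with
`i ≠ j` are adjacent if they can be completed, by suitable `a_u ∘ m_u` for the remaining indices
`u`, to a family generating `L_k`. All vertices are of the form `a_i ∘ m`; for convenience the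
graph lives on the whole of `L_k`, where the other elements are isolated. -/
def localGraph {L : Type u} [Group L] {t : ℕ} (a : Fin t → L) (k : ℕ) :
    SimpleGraph (crownPower L k) where
  Adj v w := v ≠ w ∧ ∃ i j : Fin t, i ≠ j ∧ ∃ m : Fin t → Fin k → socle L,
    v = circ (a i) (m i) ∧ w = circ (a j) (m j) ∧
      Subgroup.closure (Set.range fun u => circ (a u) (m u)) = ⊤
  symm := ⟨fun _ _ ⟨hne, i, j, hij, m, hv, hw, hgen⟩ =>
    ⟨hne.symm, j, i, hij.symm, m, hw, hv, hgen⟩⟩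
  loopless := ⟨fun _ h => h.1 rfl⟩

/-- The graph `Δ_{a_1, …, a_t}(L_k)`: remove the isolated vertices. -/
def localRankGraph {L : Type u} [Group L] {t : ℕ} (a : Fin t → L) (k : ℕ) :
    SimpleGraph (localGraph a k).support :=
  removeIsolated (localGraph a k)

/-- `Δ_{a_1, …, a_t}(L_k)` is weakly connected: for each `i`, whenever `a_i ∘ m₁` and `a_i ∘ m₂`
are vertices of it, some conjugate `(a_i ∘ m₂)^m = m⁻¹ (a_i ∘ m₂) m` with
`m ∈ M = (soc L)^k` is a vertex in the connected component of `a_i ∘ m₁`.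
(As an element of `L_k`, `m` is `1 ∘ m`.) -/
def WeaklyConnected {L : Type u} [Group L] {t : ℕ} (a : Fin t → L) (k : ℕ) : Prop :=
  ∀ (i : Fin t) (m₁ m₂ : Fin k → socle L)
    (h₁ : circ (a i) m₁ ∈ (localGraph a k).support),
    circ (a i) m₂ ∈ (localGraph a k).support →
    ∃ (m : Fin k → socle L)
      (h : (circ 1 m)⁻¹ * circ (a i) m₂ * circ 1 m ∈ (localGraph a k).support),
      (localRankGraph a k).Reachable ⟨circ (a i) m₁, h₁⟩
        ⟨(circ 1 m)⁻¹ * circ (a i) m₂ * circ 1 m, h⟩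

/-- The crown-based power `L_k` is `t`-locally connected: `Δ_{a_1, …, a_t}(L_k)` is weakly
connected whenever `a_1, …, a_t` generate `L`. -/
def LocallyConnected (L : Type u) [Group L] (k t : ℕ) : Prop :=
  ∀ a : Fin t → L, Subgroup.closure (Set.range a) = ⊤ → WeaklyConnected a k

end RankGraph

/-! Generating sets of size `d` are replaced by generating `d`-tuples, repetitions allowed. `CoOccur
d x x` says that `x` is an entry of some generating `d`-tuple, and the aim is that any two such
elements are `Linked`. The tuple form suits quotients, Gaschütz lifting and Nielsen moves.

The proof is by induction on `|G|`. For a nontrivial normal `U`, entries of generating tuples of `G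
⧸ U` are linked by induction, and a relative Gaschütz lemma (`Generates.exists_lift`) lifts each
path step by step from a prescribed starting point. It remains to link `x` and `y` congruent modulo
`U`, for one well-chosen `U`.

If there is an abelian minimal normal subgroup `N`, take `U = N`. Non-generating lifts of a tuple
generate complements of `N`, so they form an affine family. If two congruent entries were not
linked, Nielsen moves would force the directions of this family to fill all of `N^d`, and then no
lift would generate (`rel_of_affine_slices`).

Otherwise, take a largest monolithic quotient `L` with non-abelian socle, then the largest `k` such
that `L_k` is an image of `G`, by `φ` say. Let `U` be the product of minimal normal subgroups
surviving in the `k` coordinates. Then `G` is the fibre product of `G ⧸ U` and `L_k` over `L ⧸ socle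
L`, and maximality of `L` and `k` ensures that a tuple generates `G` as soon as its images generate
both factors (`exists_isCrownComplement`). Fixing the tuple modulo `U`, paths of the local graph of
`L_k` lift to `G`. Weak connectivity suffices because an entry of a generating tuple is linked to
all its conjugates (`Generates.linked_conj`). -/

namespace RankGraph

/-! ### Generating tuples -/

/-- The tuple `f` generates the group. -/
def Generates {G : Type u} [Group G] {d : ℕ} (f : Fin d → G) : Prop :=
  Subgroup.closure (Set.range f) = ⊤

/-- Two elements occur in a common generating `d`-tuple. -/
def CoOccur {G : Type u} [Group G] (d : ℕ) (x y : G) : Prop :=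
  ∃ f : Fin d → G, Generates f ∧ x ∈ Set.range f ∧ y ∈ Set.range f

/-- The equivalence relation generated by `CoOccur`. -/
def Linked {G : Type u} [Group G] (d : ℕ) (x y : G) : Prop :=
  Relation.ReflTransGen (CoOccur d) x y

section
variable {G : Type u} [Group G] {d : ℕ}

theorem CoOccur.symm {x y : G} (h : CoOccur d x y) : CoOccur d y x := by
  obtain ⟨f, hf, hx, hy⟩ := h
  exact ⟨f, hf, hy, hx⟩

theorem CoOccur.linked {x y : G} (h : CoOccur d x y) : Linked d x y :=
  Relation.ReflTransGen.single h

theorem Linked.refl (x : G) : Linked d x x := Relation.ReflTransGen.refl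

theorem Linked.symm {x y : G} (h : Linked d x y) : Linked d y x := by
  have : Std.Symm (CoOccur (G := G) d) := ⟨fun _ _ h => h.symm⟩
  exact Std.Symm.symm (r := Relation.ReflTransGen (CoOccur (G := G) d)) _ _ h

theorem Linked.trans {x y z : G} (h : Linked d x y) (h' : Linked d y z) : Linked d x z :=
  Relation.ReflTransGen.trans h h'

theorem Generates.coOccur {f : Fin d → G} (hf : Generates f) (i j : Fin d) :
    CoOccur d (f i) (f j) := ⟨f, hf, ⟨i, rfl⟩, ⟨j, rfl⟩⟩

theorem Generates.linked {f : Fin d → G} (hf : Generates f) (i j : Fin d) :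
    Linked d (f i) (f j) := (hf.coOccur i j).linked

theorem Generates.map {H : Type*} [Group H] {f : Fin d → G} (hf : Generates f) (φ : G →* H)
    (hφ : Function.Surjective φ) : Generates (fun i => φ (f i)) := by
  unfold Generates at *
  rw [show (fun i => φ (f i)) = φ ∘ f from rfl, Set.range_comp, ← MonoidHom.map_closure, hf,
    Subgroup.map_top_of_surjective _ hφ]

theorem Generates.of_mem_closure {f f' : Fin d → G} (hf : Generates f)
    (h : ∀ i, f i ∈ Subgroup.closure (Set.range f')) : Generates f' := by
  unfold Generates at *
  rw [eq_top_iff, ← hf, Subgroup.closure_le]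
  rintro _ ⟨i, rfl⟩
  exact h i

theorem Generates.perm {f : Fin d → G} (hf : Generates f) (σ : Equiv.Perm (Fin d)) :
    Generates (fun i => f (σ i)) := by
  unfold Generates at *
  rw [← hf]
  congr 1
  exact σ.surjective.range_comp f

theorem CoOccur.conj {x y : G} (h : CoOccur d x y) (g : G) :
    CoOccur d (g * x * g⁻¹) (g * y * g⁻¹) := by
  obtain ⟨f, hf, ⟨i, rfl⟩, ⟨j, rfl⟩⟩ := h
  exact ⟨_, hf.map (MulAut.conj g).toMonoidHom (MulAut.conj g).surjective, ⟨i, rfl⟩, ⟨j, rfl⟩⟩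

theorem Linked.conj {x y : G} (h : Linked d x y) (g : G) :
    Linked d (g * x * g⁻¹) (g * y * g⁻¹) :=
  Relation.ReflTransGen.lift (r := CoOccur d) (p := CoOccur d) (fun x => g * x * g⁻¹)
    (fun _ _ h' => CoOccur.conj h' g) _ _ h

/-- The classes of `Linked` on generating elements are invariant under conjugation. -/
theorem Generates.linked_conj {f : Fin d → G} (hf : Generates f) (i : Fin d) (g : G) :
    Linked d (f i) (g * f i * g⁻¹) := by
  have hg : g ∈ Subgroup.closure (Set.range f) := by rw [hf]; trivial
  induction hg using Subgroup.closure_induction with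
  | mem g hg =>
    obtain ⟨j, rfl⟩ := hg
    -- Conjugating the link from `f i` to `f j` by `f j` fixes its second end, so `f j` is linked to
    -- both `f i` and its conjugate.
    have h := (hf.linked i j).conj (f j)
    rw [mul_inv_cancel_right] at h
    exact (hf.linked i j).trans h.symm
  | one => simpa using Linked.refl (f i)
  | mul a b _ _ ha hb =>
    have := ha.trans (hb.conj a)
    simpa [mul_assoc] using this
  | inv a _ ha =>
    have := (ha.conj a⁻¹).symm
    simpa [mul_assoc] using this

end

/-! ### Lifting generating tuples -/

open Classical in
theorem card_le_eq_card_eq_add_sum {A P : Type*} [Fintype A] [PartialOrder P] [Fintype P]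
    (γ : A → P) (p : P) :
    (Finset.univ.filter fun a => γ a ≤ p).card = (Finset.univ.filter fun a => γ a = p).card +
      ∑ q ∈ Finset.univ.filter (fun q => q < p), (Finset.univ.filter fun a => γ a = q).card := by
  rw [Finset.card_eq_sum_card_fiberwise (s := Finset.univ.filter fun a => γ a ≤ p)
      (t := insert p (Finset.univ.filter fun q => q < p)) (f := γ)
      (by intro a; simp [le_iff_eq_or_lt]), Finset.sum_insert (by simp)]
  congr 1
  · congr 1
    ext a
    simp only [Finset.mem_filter, Finset.mem_univ, true_and]
    exact ⟨fun h => h.2, fun h => ⟨h.le, h⟩⟩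
  · refine Finset.sum_congr rfl fun q hq => ?_
    congr 1
    ext a
    simp only [Finset.mem_filter, Finset.mem_univ, true_and] at hq ⊢
    exact ⟨fun h => h.2, fun h => ⟨h.le.trans hq.le, h⟩⟩

open Classical in
/-- Two maps from finite types to a finite poset which take values below each given element
equally often take each value equally often. -/
theorem card_fiber_eq_of_card_le_eq {A B P : Type*} [Fintype A] [Fintype B] [PartialOrder P]
    [Fintype P] (α : A → P) (β : B → P)
    (h : ∀ p, (Finset.univ.filter fun a => α a ≤ p).card =
      (Finset.univ.filter fun b => β b ≤ p).card) (p : P) :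
    (Finset.univ.filter fun a => α a = p).card =
      (Finset.univ.filter fun b => β b = p).card := by
  induction p using WellFoundedLT.induction with
  | ind p ih =>
    have hp := h p
    rw [card_le_eq_card_eq_add_sum, card_le_eq_card_eq_add_sum,
      Finset.sum_congr rfl (fun q hq => ih q (by simpa using hq))] at hp
    exact Nat.add_right_cancel hp

section
variable {G : Type u} [Group G] {d : ℕ}

/-- The tuples congruent to `p` modulo `K` whose `i`-th entry is `x`. -/
abbrev Lifts (K : Subgroup G) (i : Fin d) (x : G) (p : Fin d → G) : Type u :=
  {q : Fin d → G // q i = x ∧ ∀ u, (p u)⁻¹ * q u ∈ K}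

/-- Given representatives `h`, `h'` in `H` of two tuples modulo `K`, the lifts of the first
tuple in `H` can be translated to lifts of the second one. -/
theorem card_lifts_le [Finite G] {K H : Subgroup G} [K.Normal] {i : Fin d} {x : G}
    {p p' h h' : Fin d → G} (hh : ∀ u, h u ∈ H) (hh' : ∀ u, h' u ∈ H)
    (hp : ∀ u, (p u)⁻¹ * h u ∈ K) (hp' : ∀ u, (p' u)⁻¹ * h' u ∈ K)
    (hi : h i = x) (hi' : h' i = x) :
    Nat.card {q : Lifts K i x p // Subgroup.closure (Set.range q.1) ≤ H} ≤
      Nat.card {q : Lifts K i x p' // Subgroup.closure (Set.range q.1) ≤ H} := by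
  refine Nat.card_le_card_of_injective
    (fun q => ⟨⟨fun u => h' u * (h u)⁻¹ * q.1.1 u, ?_, fun u => ?_⟩, ?_⟩) ?_
  · simp [hi, hi', q.1.2.1]
  · have h1 := K.mul_mem (K.inv_mem (hp u)) (q.1.2.2 u)
    have h2 := K.mul_mem (hp' u) h1
    simpa [mul_assoc] using h2
  · rw [Subgroup.closure_le]
    rintro _ ⟨u, rfl⟩
    exact H.mul_mem (H.mul_mem (hh' u) (H.inv_mem (hh u)))
      (q.2 (Subgroup.subset_closure ⟨u, rfl⟩))
  · intro q q' hqq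
    apply Subtype.ext
    apply Subtype.ext
    funext u
    have := congrFun (congrArg (fun z => z.1.1) hqq) u
    simpa using this

theorem exists_mem_of_sup_eq_top {K H : Subgroup G} [K.Normal] (hHK : H ⊔ K = ⊤) (g : G) :
    ∃ h ∈ H, g⁻¹ * h ∈ K := by
  have hg : g ∈ H ⊔ K := by rw [hHK]; trivial
  rw [← SetLike.mem_coe, Subgroup.mul_normal] at hg
  obtain ⟨h, hh, k, hk, rfl⟩ := hg
  exact ⟨h, hh, by simpa using K.inv_mem hk⟩

theorem exists_mem_tuple_of_sup_eq_top {K H : Subgroup G} [K.Normal] (hHK : H ⊔ K = ⊤)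
    (p : Fin d → G) {i : Fin d} (hi : p i ∈ H) :
    ∃ h : Fin d → G, h i = p i ∧ (∀ u, h u ∈ H) ∧ ∀ u, (p u)⁻¹ * h u ∈ K := by
  classical
  choose h hh hK using fun u => exists_mem_of_sup_eq_top hHK (p u)
  refine ⟨Function.update h i (p i), by simp, fun u => ?_, fun u => ?_⟩
  · rcases eq_or_ne u i with rfl | hu
    · simpa using hi
    · simpa [hu] using hh u
  · rcases eq_or_ne u i with rfl | hu
    · simp
    · simpa [hu] using hK u

theorem sup_eq_top_of_lift {K H : Subgroup G} {p q : Fin d → G}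
    (hp : Subgroup.closure (Set.range p) ⊔ K = ⊤) (hq : ∀ u, (p u)⁻¹ * q u ∈ K)
    (hH : Subgroup.closure (Set.range q) ≤ H) : H ⊔ K = ⊤ := by
  rw [eq_top_iff, ← hp, sup_le_iff, Subgroup.closure_le]
  refine ⟨?_, le_sup_right⟩
  rintro _ ⟨u, rfl⟩
  have h1 : q u ∈ H ⊔ K := le_sup_left (a := H) (hH (Subgroup.subset_closure ⟨u, rfl⟩))
  have h2 := (H ⊔ K).mul_mem h1 ((H ⊔ K).inv_mem (le_sup_right (a := H) (hq u)))
  simpa using h2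

/-- A subgroup `H` can contain lifts only if `H ⊔ K = ⊤` and `x ∈ H`. In that case translation
inside `H` matches the lifts of `p` with those of `p'`; otherwise both counts are zero. -/
theorem card_lifts_closure_le_eq [Finite G] {K : Subgroup G} [K.Normal] {i : Fin d} {x : G}
    {p p' : Fin d → G} (hp : Subgroup.closure (Set.range p) ⊔ K = ⊤)
    (hp' : Subgroup.closure (Set.range p') ⊔ K = ⊤) (hi : p i = x) (hi' : p' i = x)
    (H : Subgroup G) :
    Nat.card {q : Lifts K i x p // Subgroup.closure (Set.range q.1) ≤ H} =
      Nat.card {q : Lifts K i x p' // Subgroup.closure (Set.range q.1) ≤ H} := by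
  by_cases hH : H ⊔ K = ⊤ ∧ x ∈ H
  · obtain ⟨hHK, hx⟩ := hH
    obtain ⟨h, h1, h2, h3⟩ := exists_mem_tuple_of_sup_eq_top hHK p (i := i) (by rwa [hi])
    obtain ⟨h', h1', h2', h3'⟩ := exists_mem_tuple_of_sup_eq_top hHK p' (i := i) (by rwa [hi'])
    exact le_antisymm (card_lifts_le h2 h2' h3 h3' (h1.trans hi) (h1'.trans hi'))
      (card_lifts_le h2' h2 h3' h3 (h1'.trans hi') (h1.trans hi))
  · have key : ∀ p : Fin d → G, Subgroup.closure (Set.range p) ⊔ K = ⊤ →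
        IsEmpty {q : Lifts K i x p // Subgroup.closure (Set.range q.1) ≤ H} := by
      refine fun p hp => ⟨fun q => hH ⟨sup_eq_top_of_lift hp q.1.2.2 q.2, ?_⟩⟩
      have := q.2 (Subgroup.subset_closure ⟨i, rfl⟩)
      rwa [q.1.2.1] at this
    have := key p hp
    have := key p' hp'
    rw [Nat.card_of_isEmpty, Nat.card_of_isEmpty]

/-- A relative form of Gaschütz' lemma: if `p` generates the group, then each tuple `p'`
generating it modulo `K` and having its `i`-th entry in common with `p` is congruent modulo `K`
to a generating tuple with the same `i`-th entry. -/
theorem Generates.exists_lift [Finite G] {K : Subgroup G} [K.Normal] {p p' : Fin d → G}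
    (hp : Generates p) (hp' : Subgroup.closure (Set.range p') ⊔ K = ⊤) (i : Fin d)
    (hi : p' i = p i) :
    ∃ q : Fin d → G, Generates q ∧ q i = p i ∧ ∀ u, (p' u)⁻¹ * q u ∈ K := by
  classical
  have := Fintype.ofFinite (Subgroup G)
  have := Fintype.ofFinite (Lifts K i (p i) p)
  have := Fintype.ofFinite (Lifts K i (p i) p')
  -- Since the counts below every `H` agree, so do the counts of lifts generating exactly `⊤`; for
  -- `p` this count includes `p` itself.
  have h := card_fiber_eq_of_card_le_eq
    (fun q : Lifts K i (p i) p => Subgroup.closure (Set.range q.1))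
    (fun q : Lifts K i (p i) p' => Subgroup.closure (Set.range q.1)) (fun H => by
      have := card_lifts_closure_le_eq (K := K) (i := i) (x := p i) (p := p) (p' := p')
        (by rw [show Subgroup.closure (Set.range p) = ⊤ from hp, top_sup_eq]) hp' rfl hi H
      rwa [Nat.card_eq_fintype_card, Nat.card_eq_fintype_card, Fintype.card_subtype,
        Fintype.card_subtype] at this)
    ⊤
  have hpos : 0 < (Finset.univ.filter fun q : Lifts K i (p i) p =>
      Subgroup.closure (Set.range q.1) = ⊤).card :=
    Finset.card_pos.2 ⟨⟨p, rfl, by simp⟩, Finset.mem_filter.2 ⟨Finset.mem_univ _, hp⟩⟩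
  rw [h] at hpos
  obtain ⟨q, hq⟩ := Finset.card_pos.1 hpos
  exact ⟨q.1, (Finset.mem_filter.1 hq).2, q.2.1, q.2.2⟩

theorem Generates.exists_lift_of_mem_range [Finite G] {K : Subgroup G} [K.Normal]
    {p p' : Fin d → G} (hp : Generates p)
    (hp' : Subgroup.closure (Set.range p') ⊔ K = ⊤) (i : Fin d) (hi : p' i ∈ Set.range p) :
    ∃ q : Fin d → G, Generates q ∧ q i = p' i ∧ ∀ u, (p' u)⁻¹ * q u ∈ K := by
  obtain ⟨j, hj⟩ := hi
  have h := (hp.perm (Equiv.swap i j)).exists_lift hp' i (by simp [hj])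
  simpa [hj] using h

/-- Paths between generating elements can be lifted from a quotient. -/
theorem exists_linked_of_linked_quotient [Finite G] (K : Subgroup G) [K.Normal] {x : G}
    (hx : CoOccur d x x) {z : G ⧸ K} (h : Linked d (x : G ⧸ K) z) :
    ∃ y : G, CoOccur d y y ∧ (y : G ⧸ K) = z ∧ Linked d x y := by
  classical
  induction h with
  | refl => exact ⟨x, hx, rfl, Linked.refl x⟩
  | tail _ hstep ih =>
    obtain ⟨y, ⟨p, hp, hyp, -⟩, hyb, hxy⟩ := ih
    obtain ⟨f, hf, ⟨i, hi⟩, ⟨j, hj⟩⟩ := hstep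
    -- The `i`-th entry is prescribed to be the endpoint `y` reached so far, so that the lifted edge
    -- starts there.
    let p' : Fin d → G := Function.update (fun u => (f u).out) i y
    have hp'f : ∀ u, ((p' u : G) : G ⧸ K) = f u := by
      intro u
      rcases eq_or_ne u i with rfl | hu
      · simp [p', hyb, hi]
      · simp [p', hu]
    have hp' : Subgroup.closure (Set.range p') ⊔ K = ⊤ := by
      have h1 : (Subgroup.closure (Set.range p')).map (QuotientGroup.mk' K) = ⊤ := by
        rw [MonoidHom.map_closure, ← Set.range_comp, ← hf]
        congr 2
        funext u
        exact hp'f u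
      have h2 := congrArg (Subgroup.comap (QuotientGroup.mk' K)) h1
      rwa [Subgroup.comap_map_eq, QuotientGroup.ker_mk', Subgroup.comap_top] at h2
    have hi' : p' i = y := by simp [p']
    obtain ⟨q, hq, hqi, hqK⟩ := hp.exists_lift_of_mem_range hp' i (by rwa [hi'])
    refine ⟨q j, hq.coOccur j j, ?_, hxy.trans ?_⟩
    · rw [← hj, ← hp'f j]
      exact (QuotientGroup.eq.2 (hqK j)).symm
    · have := hq.linked i j
      rwa [hqi, hi'] at this

end

/-! ### Abelian minimal normal subgroups -/

section
variable {G : Type u} [Group G] {d : ℕ}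

theorem IsMinimalNormal.normal {N : Subgroup G} (hN : IsMinimalNormal N) : N.Normal :=
  hN.prop.1

theorem IsMinimalNormal.ne_bot {N : Subgroup G} (hN : IsMinimalNormal N) : N ≠ ⊥ :=
  hN.prop.2

theorem IsMinimalNormal.le_of_inf_ne_bot {N K : Subgroup G} (hN : IsMinimalNormal N)
    (hK : K.Normal) (h : K ⊓ N ≠ ⊥) : N ≤ K := by
  have := hN.normal
  exact (hN.le_of_le ⟨inferInstance, h⟩ inf_le_right).trans inf_le_left

/-- The elements of the subgroup commute with each other. -/
def IsAbelianSubgroup (N : Subgroup G) : Prop := ∀ a ∈ N, ∀ b ∈ N, a * b = b * a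

/-- `H ⊓ N` is normalized by `H` and centralized by the abelian `N`, hence normal in `G`. By
minimality it is trivial or contains `N`, and the latter would give `H = ⊤`. -/
theorem IsMinimalNormal.inf_eq_bot_of_abelian {N H : Subgroup G} (hN : IsMinimalNormal N)
    (hab : IsAbelianSubgroup N) (hHN : H ⊔ N = ⊤) (hH : H ≠ ⊤) : H ⊓ N = ⊥ := by
  have hNn := hN.normal
  have hnorm : (H ⊓ N).Normal := by
    rw [← Subgroup.normalizer_eq_top_iff, eq_top_iff, ← hHN, sup_le_iff]
    constructor
    · intro h hh
      rw [Subgroup.mem_normalizer_iff]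
      intro g
      rw [Subgroup.mem_inf, Subgroup.mem_inf, ← hNn.mem_comm_iff, inv_mul_cancel_left,
        H.mul_mem_cancel_right (H.inv_mem hh), H.mul_mem_cancel_left hh]
    · intro n hn
      rw [Subgroup.mem_normalizer_iff]
      intro g
      have key : ∀ g ∈ N, n * g * n⁻¹ = g := fun g hg => by rw [hab n hn g hg]; group
      constructor
      · intro hg
        rwa [key g hg.2]
      · intro hg
        have h2 : g ∈ N := by
          have := hNn.conj_mem _ hg.2 n⁻¹
          simpa [mul_assoc] using this
        rwa [key g h2] at hg
  by_contra hne
  have hle : N ≤ H := (hN.le_of_le ⟨hnorm, hne⟩ inf_le_right).trans inf_le_left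
  exact hH (by rwa [sup_eq_left.2 hle] at hHN)

/-- In an extension of an abelian normal subgroup, words are affine functions. -/
theorem lift_affine {N : Subgroup G} [N.Normal] (hab : IsAbelianSubgroup N)
    {f₁ f₂ f₃ : Fin d → G} (h₁ : ∀ u, (f₂ u)⁻¹ * f₁ u ∈ N) (h₃ : ∀ u, (f₂ u)⁻¹ * f₃ u ∈ N)
    (w : FreeGroup (Fin d)) :
    ((FreeGroup.lift f₂ w)⁻¹ * FreeGroup.lift f₁ w ∈ N ∧
      (FreeGroup.lift f₂ w)⁻¹ * FreeGroup.lift f₃ w ∈ N) ∧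
    FreeGroup.lift (fun u => f₁ u * (f₂ u)⁻¹ * f₃ u) w =
      FreeGroup.lift f₁ w * (FreeGroup.lift f₂ w)⁻¹ * FreeGroup.lift f₃ w := by
  have hN : N.Normal := inferInstance
  have hinv : ∀ a b : G, b⁻¹ * a ∈ N → b * a⁻¹ ∈ N := fun a b h => by
    have := hN.conj_mem _ (N.inv_mem h) b
    simpa [mul_assoc] using this
  have hmul : ∀ a b a' b' : G, b⁻¹ * a ∈ N → b'⁻¹ * a' ∈ N → (b * b')⁻¹ * (a * a') ∈ N := by
    intro a b a' b' h h'
    have := N.mul_mem (hN.conj_mem _ h b'⁻¹) h'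
    simpa [mul_assoc] using this
  induction w using FreeGroup.induction_on with
  | C1 => simp
  | of u => simpa using ⟨h₁ u, h₃ u⟩
  | inv_of u _ =>
    simp only [map_inv, FreeGroup.lift_apply_of, inv_inv]
    refine ⟨⟨hinv _ _ (h₁ u), hinv _ _ (h₃ u)⟩, ?_⟩
    have h := hab _ (N.inv_mem (hinv _ _ (h₁ u))) _ (N.inv_mem (hinv _ _ (h₃ u)))
    rw [mul_inv_rev, inv_inv, mul_inv_rev, inv_inv] at h
    have h' : f₁ u * (f₂ u)⁻¹ * f₃ u = f₃ u * (f₂ u)⁻¹ * f₁ u := by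
      have := congrArg (· * f₂ u) h
      simpa [mul_assoc] using this
    rw [h']
    group
  | mul x y hx hy =>
    simp only [map_mul]
    refine ⟨⟨hmul _ _ _ _ hx.1.1 hy.1.1, hmul _ _ _ _ hx.1.2 hy.1.2⟩, ?_⟩
    rw [hx.2, hy.2]
    have h := hab _ hx.1.2 _ (N.inv_mem (hinv _ _ hy.1.1))
    rw [mul_inv_rev, inv_inv] at h
    have h2 := congrArg (fun z => FreeGroup.lift f₁ x * z * FreeGroup.lift f₃ y) h
    simpa [mul_assoc] using h2

theorem closure_range_eq_range_lift (f : Fin d → G) :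
    Subgroup.closure (Set.range f) = (FreeGroup.lift f).range :=
  FreeGroup.range_lift_eq_closure.symm

/-- If `N` is an abelian minimal normal subgroup, the tuples of `N^d` giving a non-generating
lift are closed under `(q₁, q₂, q₃) ↦ q₁ q₂⁻¹ q₃`. -/
theorem not_generates_affine {N : Subgroup G} (hN : IsMinimalNormal N)
    (hab : IsAbelianSubgroup N) {f : Fin d → G}
    (hf : Subgroup.closure (Set.range f) ⊔ N = ⊤) {q₁ q₂ q₃ : Fin d → N}
    (h₁ : ¬ Generates fun u => f u * q₁ u) (h₂ : ¬ Generates fun u => f u * q₂ u)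
    (h₃ : ¬ Generates fun u => f u * q₃ u) :
    ¬ Generates fun u => f u * (q₁ * q₂⁻¹ * q₃) u := by
  have hNn := hN.normal
  -- A non-generating lift generates a complement of `N`. Hence a word whose value on such a lift
  -- lies in `N` has value `1` there.
  have hbot : ∀ {q : Fin d → N}, ¬ Generates (fun u => f u * q u) →
      Subgroup.closure (Set.range fun u => f u * (q u : G)) ⊓ N = ⊥ := by
    intro q hq
    refine hN.inf_eq_bot_of_abelian hab ?_ hq
    exact sup_eq_top_of_lift (q := fun u => f u * (q u : G)) hf (by simp) le_rfl
  have e : (fun u => f u * (((q₁ * q₂⁻¹ * q₃) u : N) : G)) =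
      fun u => (f u * q₁ u) * (f u * q₂ u)⁻¹ * (f u * q₃ u) := by
    funext u
    simp [mul_assoc]
  intro hgen
  rw [e] at hgen
  have key := lift_affine (N := N) hab (f₁ := fun u => f u * (q₁ u : G))
    (f₂ := fun u => f u * (q₂ u : G)) (f₃ := fun u => f u * (q₃ u : G))
    (fun u => by simpa [mul_assoc] using N.mul_mem (N.inv_mem (q₂ u).2) (q₁ u).2)
    (fun u => by simpa [mul_assoc] using N.mul_mem (N.inv_mem (q₂ u).2) (q₃ u).2)
  apply hN.ne_bot
  rw [eq_bot_iff]
  intro n hn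
  have hn' : n ∈ Subgroup.closure (Set.range fun u => (f u * (q₁ u : G)) * (f u * q₂ u)⁻¹ *
    (f u * q₃ u)) := by rw [show Subgroup.closure _ = ⊤ from hgen]; trivial
  rw [closure_range_eq_range_lift] at hn'
  obtain ⟨w, rfl⟩ := hn'
  obtain ⟨⟨ha, hc⟩, he⟩ := key w
  rw [he] at hn ⊢
  have hone : ∀ {q : Fin d → N}, ¬ Generates (fun u => f u * q u) →
      FreeGroup.lift (fun u => f u * (q u : G)) w ∈ N →
      FreeGroup.lift (fun u => f u * (q u : G)) w = 1 := fun {q} hq hw => by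
    have := hbot hq
    rw [eq_bot_iff] at this
    exact this ⟨by rw [closure_range_eq_range_lift]; exact ⟨w, rfl⟩, hw⟩
  have hC : FreeGroup.lift (fun u => f u * (q₃ u : G)) w ∈ N := by
    have h := hNn.conj_mem _ ha (FreeGroup.lift (fun u => f u * (q₂ u : G)) w)
    rw [mul_inv_cancel_left] at h
    exact (N.mul_mem_cancel_left h).1 hn
  have hB : FreeGroup.lift (fun u => f u * (q₂ u : G)) w ∈ N :=
    N.inv_mem_iff.1 ((N.mul_mem_cancel_right hC).1 hc)
  have hA := (N.mul_mem_cancel_left (N.inv_mem hB)).1 ha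
  rw [hone h₁ hA, hone h₂ hB, hone h₃ hC]
  simp

theorem Generates.update_mul_inv {p : Fin d → G} (hp : Generates p)
    {i j : Fin d} (hij : i ≠ j) : Generates (Function.update p j (p j * (p i)⁻¹)) := by
  refine hp.of_mem_closure fun u => ?_
  have hmem : ∀ u, Function.update p j (p j * (p i)⁻¹) u ∈
      Subgroup.closure (Set.range (Function.update p j (p j * (p i)⁻¹))) :=
    fun u => Subgroup.subset_closure ⟨u, rfl⟩
  rcases eq_or_ne u j with rfl | hu
  · have h1 := hmem u
    have h2 := hmem i
    rw [Function.update_self] at h1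
    rw [Function.update_of_ne hij] at h2
    simpa using Subgroup.mul_mem _ h1 h2
  · have := hmem u
    rwa [Function.update_of_ne hu] at this

/-- A family of ternary-closed proper subsets `Q n` of `N^d`, insensitive to the `i`-th
coordinate, which interacts with a transitive relation as bad lifts do with linkedness. -/
theorem rel_of_affine_slices {N : Type*} [Group N] {i : Fin d} {Q : N → (Fin d → N) → Prop}
    {R : N → N → Prop} (hR : ∀ {a b c}, R a b → R b c → R a c)
    (hT : ∀ {n₁ n₂ n₃ m₁ m₂ m₃}, Q n₁ m₁ → Q n₂ m₂ → Q n₃ m₃ →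
      Q (n₁ * n₂⁻¹ * n₃) (m₁ * m₂⁻¹ * m₃))
    (hi : ∀ {n m} w, Q n m → Q n (m * Pi.mulSingle i w))
    (h1 : ∀ {n₁ n₂ : N}, ¬ R n₁ n₂ → ∀ m, Q n₁ m ∨ Q n₂ m)
    (h2 : ∀ {n₁ n₂ : N}, ¬ R n₁ n₂ → ∀ j, i ≠ j → ∀ m, ¬ Q n₁ m →
      Q n₂ (m * Pi.mulSingle j (n₁⁻¹ * n₂)))
    {n : N} (h0 : ∃ m, ¬ Q 1 m) (hn' : ∃ m, ¬ Q n m) : R 1 n := by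
  by_contra hnl'
  have hT' : ∀ {n' m₁ m₂ m₃ n₂}, Q n' m₁ → Q n₂ m₂ → Q n₂ m₃ → Q n' (m₁ * m₂⁻¹ * m₃) := by
    intro n' m₁ m₂ m₃ n₂ h₁ h₂ h₃
    simpa using hT h₁ h₂ h₃
  have hne1 : ∃ m, Q 1 m := by
    obtain ⟨m, hm⟩ := hn'
    exact ⟨m, (h1 hnl' m).resolve_right hm⟩
  have hproper : ∀ n', ∃ m, ¬ Q n' m := by
    by_contra! hc
    obtain ⟨n', hc'⟩ := hc
    obtain ⟨m, hm⟩ := h0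
    obtain ⟨a, ha⟩ := hne1
    exact hm (by simpa using hT' ha (hc' a) (hc' m))
  -- `W` is the common direction group of the slices: by `hT'`, a difference of two points of one
  -- slice translates every slice into itself.
  let W : Subgroup (Fin d → N) :=
    { carrier := {w | ∀ n' m, Q n' m → Q n' (m * w)}
      one_mem' := fun n' m h => by simpa using h
      mul_mem' := fun {a b} ha hb n' m h => by
        rw [← mul_assoc]
        exact hb _ _ (ha _ _ h)
      inv_mem' := fun {a} ha n' m h => by
        obtain ⟨b, hb⟩ := hne1
        simpa [mul_assoc] using hT' h (ha _ _ hb) hb }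
  have hW : ∀ {n' m w}, Q n' m → Q n' (m * w) → w ∈ W := by
    intro n' m w h h' n'' m' h''
    simpa [mul_assoc] using hT' h'' h h'
  have hstab : ∀ {n₁ n₂ : N}, ¬ R n₁ n₂ → ∀ j, i ≠ j →
      Pi.mulSingle j (n₁⁻¹ * n₂) ∈ W := by
    -- A point `c` outside the slice of `n₁` lies in that of `n₂` by `h1`, and so does its translate
    -- by `h2`.
    intro n₁ n₂ h j hij
    obtain ⟨a, ha⟩ := hproper n₂
    obtain ⟨c, hc⟩ := hproper n₁
    have ha' := (h1 h a).resolve_right ha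
    have hc' := (h1 h c).resolve_left hc
    exact hW hc' (h2 h j hij c hc)
  have hall : ∀ w, w ∈ W := by
    refine fun w => Subgroup.pi_mem_of_mulSingle_mem w fun j => ?_
    rcases eq_or_ne i j with rfl | hij
    · intro n' m h
      exact hi _ h
    -- If `1` is related to `w j`, then `w j` is not related to `n`. So `n` and `(w j)⁻¹ * n` are
    -- both directions at `j`, and hence so is `w j`.
    · by_cases hl : R 1 (w j)
      · have hl' : ¬ R (w j) n := fun h => hnl' (hR hl h)
        have := W.mul_mem (hstab hnl' j hij) (W.inv_mem (hstab hl' j hij))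
        rw [← Pi.mulSingle_inv, ← Pi.mulSingle_mul] at this
        simpa using this
      · simpa using hstab hl j hij
  obtain ⟨m, hm⟩ := h0
  obtain ⟨a, ha⟩ := hne1
  exact hm (by simpa using hall (a⁻¹ * m) _ _ ha)

theorem Generates.exists_generates_update [Finite G] {N : Subgroup G}
    [N.Normal] {f : Fin d → G} (hf : Generates f) (i : Fin d) (n : N)
    (hn : CoOccur d (f i * n) (f i * n)) :
    ∃ m : Fin d → N, Generates fun u => f u * (Function.update m i n u : N) := by
  have hfN : Subgroup.closure (Set.range f) ⊔ N = ⊤ := by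
    rw [show Subgroup.closure _ = ⊤ from hf, top_sup_eq]
  obtain ⟨p, hp, hp', -⟩ := hn
  obtain ⟨q, hq, hqi, hqN⟩ := hp.exists_lift_of_mem_range (K := N)
    (p' := Function.update f i (f i * n))
    (sup_eq_top_of_lift hfN (q := Function.update f i (f i * n)) (fun u => by
      rcases eq_or_ne u i with rfl | hu
      · simp
      · simp [hu]) le_rfl) i (by simpa using hp')
  have hqN' : ∀ u, (f u)⁻¹ * q u ∈ N := by
    intro u
    rcases eq_or_ne u i with rfl | hu
    · simp [hqi]
    · simpa [hu] using hqN u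
  refine ⟨fun u => ⟨_, hqN' u⟩, ?_⟩
  convert hq using 2 with u
  rcases eq_or_ne u i with rfl | hu
  · simp [hqi]
  · simp [hu]

/-- The lift of `f` by `m`, with the `i`-th entry replaced by `f i * n`, does not generate. -/
def BadLift {N : Subgroup G} (f : Fin d → G) (i : Fin d) (n : N) (m : Fin d → N) : Prop :=
  ¬ Generates fun u => f u * (Function.update m i n u : N)

theorem badLift_affine {N : Subgroup G} (hN : IsMinimalNormal N)
    (hab : IsAbelianSubgroup N) {f : Fin d → G}
    (hf : Subgroup.closure (Set.range f) ⊔ N = ⊤) {i : Fin d} {n₁ n₂ n₃ : N}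
    {m₁ m₂ m₃ : Fin d → N} (h₁ : BadLift f i n₁ m₁) (h₂ : BadLift f i n₂ m₂)
    (h₃ : BadLift f i n₃ m₃) : BadLift f i (n₁ * n₂⁻¹ * n₃) (m₁ * m₂⁻¹ * m₃) := by
  have h := not_generates_affine hN hab hf h₁ h₂ h₃
  have e : Function.update m₁ i n₁ * (Function.update m₂ i n₂)⁻¹ * Function.update m₃ i n₃ =
      Function.update (m₁ * m₂⁻¹ * m₃) i (n₁ * n₂⁻¹ * n₃) := by
    rw [← Function.update_inv, ← Function.update_mul, ← Function.update_mul]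
  rw [e] at h
  exact h

theorem linked_of_not_badLift {N : Subgroup G} {f : Fin d → G} {i j : Fin d} (hij : i ≠ j)
    {n : N} {m : Fin d → N} (h : ¬ BadLift f i n m) : Linked d (f i * n) (f j * m j) := by
  have := (not_not.1 h).linked i j
  rwa [Function.update_self, Function.update_of_ne hij.symm] at this

theorem linked_mul_inv_of_not_badLift {N : Subgroup G} {f : Fin d → G} {i j : Fin d}
    (hij : i ≠ j) {n : N} {m : Fin d → N} (h : ¬ BadLift f i n m) :
    Linked d (f i * n) (f j * m j * (f i * n)⁻¹) := by
  have := ((not_not.1 h).update_mul_inv hij).linked i j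
  simpa only [Function.update_self, Function.update_of_ne hij,
    Function.update_of_ne hij.symm] using this

/-- Generating elements which are congruent modulo an abelian minimal normal subgroup are
linked. -/
theorem Generates.linked_mul_of_abelian [Finite G] (hd : 2 ≤ d) {N : Subgroup G}
    (hN : IsMinimalNormal N) (hab : IsAbelianSubgroup N) {f : Fin d → G} (hf : Generates f)
    (i : Fin d) (n : N) (hn : CoOccur d (f i * n) (f i * n)) : Linked d (f i) (f i * n) := by
  have hNn := hN.normal
  have hfN : Subgroup.closure (Set.range f) ⊔ N = ⊤ := by
    rw [show Subgroup.closure _ = ⊤ from hf, top_sup_eq]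
  have h1 : ∀ {n₁ n₂ : N}, ¬ Linked d (f i * n₁) (f i * n₂) → ∀ m,
      BadLift f i n₁ m ∨ BadLift f i n₂ m := by
    intro n₁ n₂ h m
    by_contra! hc
    obtain ⟨j, hj⟩ : ∃ j : Fin d, j ≠ i :=
      have : Nontrivial (Fin d) := Fin.nontrivial_iff_two_le.2 hd
      exists_ne i
    exact h ((linked_of_not_badLift hj.symm hc.1).trans
      (linked_of_not_badLift hj.symm hc.2).symm)
  have h2 : ∀ {n₁ n₂ : N}, ¬ Linked d (f i * n₁) (f i * n₂) → ∀ j, i ≠ j → ∀ m,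
      ¬ BadLift f i n₁ m → BadLift f i n₂ (m * Pi.mulSingle j (n₁⁻¹ * n₂)) := by
    intro n₁ n₂ h j hij m hm
    by_contra hc
    refine h ((linked_mul_inv_of_not_badLift hij hm).trans ?_)
    have b := (linked_mul_inv_of_not_badLift hij hc).symm
    rw [Pi.mul_apply, Pi.mulSingle_eq_same] at b
    -- The shift by `n₁⁻¹ * n₂` is chosen so that the two Nielsen-moved tuples share their `j`-th
    -- entry.
    have e : f j * ((m j * (n₁⁻¹ * n₂) : N) : G) * (f i * n₂)⁻¹ =
        f j * m j * (f i * n₁)⁻¹ := by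
      simp only [Subgroup.coe_mul, Subgroup.coe_inv]
      group
    rwa [e] at b
  have hi : ∀ {n m} w, BadLift (N := N) f i n m →
      BadLift f i n (m * Pi.mulSingle i w) := by
    intro n m w h
    have e : Function.update (m * Pi.mulSingle i w) i n = Function.update m i n := by
      funext u
      rcases eq_or_ne u i with rfl | hu
      · simp
      · simp [hu]
    unfold BadLift at h ⊢
    rwa [e]
  have h0 : ∃ m, ¬ BadLift f i (1 : N) m := by
    refine ⟨1, not_not.2 ?_⟩
    have e : Function.update (1 : Fin d → N) i 1 = 1 := Function.update_eq_self i _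
    rw [e]
    simpa using hf
  have hn' : ∃ m, ¬ BadLift f i n m :=
    (hf.exists_generates_update i n hn).imp fun _ => not_not.2
  have := rel_of_affine_slices (N := N) (i := i) (Q := BadLift f i) (n := n)
    (R := fun n₁ n₂ : N => Linked d (f i * n₁) (f i * n₂))
    Linked.trans (badLift_affine hN hab hfN) hi h1 h2 h0 hn'
  rwa [Subgroup.coe_one, mul_one] at this

end

/-! ### Monolithic groups -/

section
variable {G : Type u} [Group G]

theorem exists_isMinimalNormal_le [Finite G] {K : Subgroup G} (hK : K.Normal) (h : K ≠ ⊥) :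
    ∃ N, IsMinimalNormal N ∧ N ≤ K := by
  obtain ⟨N, hN, hmin⟩ :=
    (Set.toFinite {K : Subgroup G | K.Normal ∧ K ≠ ⊥}).exists_le_minimal ⟨hK, h⟩
  exact ⟨N, hmin, hN⟩

theorem commute_of_inf_eq_bot {A B : Subgroup G} (hA : A.Normal) (hB : B.Normal)
    (h : A ⊓ B = ⊥) {a b : G} (ha : a ∈ A) (hb : b ∈ B) : a * b = b * a :=
  Subgroup.commute_of_normal_of_disjoint A B hA hB (disjoint_iff.2 h) a b ha hb

theorem IsMonolithic.isMinimalNormal_socle (h : IsMonolithic G) :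
    IsMinimalNormal (socle G) := by
  obtain ⟨N, hN, huniq⟩ := h
  have : socle G = N :=
    le_antisymm (sSup_le fun K hK => (huniq K hK).le) (le_sSup hN)
  rwa [this]

theorem IsMonolithic.socle_le [Finite G] (h : IsMonolithic G) {K : Subgroup G} (hK : K.Normal)
    (hne : K ≠ ⊥) : socle G ≤ K := by
  obtain ⟨N, hN, hNK⟩ := exists_isMinimalNormal_le hK hne
  rwa [h.unique h.isMinimalNormal_socle hN]

theorem isMonolithic_of_forall_le {M : Subgroup G} (hM : M.Normal) (hne : M ≠ ⊥)
    (h : ∀ K : Subgroup G, K.Normal → K ≠ ⊥ → M ≤ K) : IsMonolithic G ∧ socle G = M := by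
  have hmin : IsMinimalNormal M := ⟨⟨hM, hne⟩, fun K hK _ => h K hK.1 hK.2⟩
  have hmono : IsMonolithic G :=
    ⟨M, hmin, fun K hK => le_antisymm (hK.le_of_le ⟨hM, hne⟩ (h K hK.prop.1 hK.prop.2))
      (h K hK.prop.1 hK.prop.2)⟩
  exact ⟨hmono, hmono.unique hmono.isMinimalNormal_socle hmin⟩

/-- In a monolithic group with non-abelian socle, only the trivial normal subgroup centralizes
the socle. -/
theorem IsMonolithic.eq_bot_of_commute [Finite G] (h : IsMonolithic G)
    (hna : HasNonabelianSocle G) {A : Subgroup G} (hA : A.Normal)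
    (hc : ∀ a ∈ A, ∀ s ∈ socle G, a * s = s * a) : A = ⊥ := by
  by_contra hne
  obtain ⟨x, hx, y, hy, hxy⟩ := hna
  exact hxy (hc x (h.socle_le hA hne hx) y hy)

/-- `N` meets its centralizer `C` trivially, so it embeds in `G ⧸ C`. A normal subgroup whose
preimage misses `N` commutes with `N`, so its preimage lies in `C`; any other preimage contains `N`.
-/
theorem IsMinimalNormal.isMonolithic_quotient_centralizer {N : Subgroup G}
    (hN : IsMinimalNormal N) (hna : ¬ IsAbelianSubgroup N) {C : Subgroup G} [C.Normal]
    (hC : C = Subgroup.centralizer (N : Set G)) :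
    IsMonolithic (G ⧸ C) ∧ HasNonabelianSocle (G ⧸ C) := by
  have hNn := hN.normal
  have hCN : C ⊓ N = ⊥ := by
    by_contra hne
    refine hna fun a ha b hb => ?_
    have := hN.le_of_inf_ne_bot inferInstance hne ha
    rw [hC, Subgroup.mem_centralizer_iff] at this
    exact (this b hb).symm
  have hinj : ∀ n ∈ N, (n : G ⧸ C) = 1 → n = 1 := fun n hn h => by
    rw [QuotientGroup.eq_one_iff] at h
    have : n ∈ C ⊓ N := ⟨h, hn⟩
    rwa [hCN] at this
  obtain ⟨h1, h2⟩ := isMonolithic_of_forall_le (M := N.map (QuotientGroup.mk' C))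
    (hNn.map _ (QuotientGroup.mk'_surjective C)) (fun hbot => hN.ne_bot (by
      rw [eq_bot_iff]
      intro n hn
      refine hinj n hn ?_
      have : (n : G ⧸ C) ∈ N.map (QuotientGroup.mk' C) := ⟨n, hn, rfl⟩
      rwa [hbot] at this)) (fun K hK hne => by
      have hK' : (K.comap (QuotientGroup.mk' C)).Normal := inferInstance
      rw [Subgroup.map_le_iff_le_comap]
      refine hN.le_of_inf_ne_bot hK' fun hbot => hne ?_
      rw [eq_bot_iff]
      intro z hz
      obtain ⟨g, rfl⟩ := QuotientGroup.mk'_surjective C z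
      have : g ∈ C := by
        rw [hC, Subgroup.mem_centralizer_iff]
        exact fun n hn => (commute_of_inf_eq_bot hK' hNn hbot hz hn).symm
      exact (QuotientGroup.eq_one_iff g).2 this)
  refine ⟨h1, ?_⟩
  unfold IsAbelianSubgroup at hna
  push Not at hna
  obtain ⟨a, ha, b, hb, hab⟩ := hna
  refine ⟨a, by rw [h2]; exact ⟨a, ha, rfl⟩, b, by rw [h2]; exact ⟨b, hb, rfl⟩, fun h => hab ?_⟩
  have h3 : a * b * (b * a)⁻¹ = 1 := hinj _ (N.mul_mem (N.mul_mem ha hb)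
    (N.inv_mem (N.mul_mem hb ha))) (by
      rw [QuotientGroup.mk_mul, QuotientGroup.mk_mul, h, QuotientGroup.mk_inv,
        QuotientGroup.mk_mul, mul_inv_cancel])
  exact mul_inv_eq_one.1 h3

/-- The kernel of an epimorphism onto a monolithic group with non-abelian socle is a prime
element of the lattice of normal subgroups. -/
theorem le_ker_or_le_ker_of_inf_le {L : Type u} [Group L] [Finite L] (hL : IsMonolithic L)
    (hna : HasNonabelianSocle L) {ψ : G →* L} (hψ : Function.Surjective ψ) {A B : Subgroup G}
    (hA : A.Normal) (hB : B.Normal) (h : A ⊓ B ≤ ψ.ker) : A ≤ ψ.ker ∨ B ≤ ψ.ker := by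
  by_contra! hc
  have hle : ∀ {A : Subgroup G}, A.Normal → ¬ A ≤ ψ.ker → socle L ≤ A.map ψ :=
    fun hA hc => hL.socle_le (hA.map ψ hψ) fun hb => hc ((Subgroup.map_eq_bot_iff _).1 hb)
  obtain ⟨x, hx, y, hy, hxy⟩ := hna
  obtain ⟨a, ha, rfl⟩ := hle hA hc.1 hx
  obtain ⟨b, hb, rfl⟩ := hle hB hc.2 hy
  have : a * b * a⁻¹ * b⁻¹ ∈ ψ.ker := h
    ⟨by simpa [mul_assoc] using A.mul_mem ha (hA.conj_mem _ (A.inv_mem ha) b),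
      B.mul_mem (hB.conj_mem _ hb a) (B.inv_mem hb)⟩
  rw [MonoidHom.mem_ker] at this
  simp only [map_mul, map_inv] at this
  exact hxy (by rwa [mul_inv_eq_one, mul_inv_eq_iff_eq_mul] at this)

/-- The intersection of the centralizers of the subgroups in `T`. -/
def centralizers (T : Set (Subgroup G)) : Subgroup G :=
  ⨅ N ∈ T, Subgroup.centralizer (N : Set G)

theorem mem_centralizers {T : Set (Subgroup G)} {g : G} :
    g ∈ centralizers T ↔ ∀ N ∈ T, g ∈ Subgroup.centralizer (N : Set G) := by
  simp only [centralizers, Subgroup.mem_iInf]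

theorem centralizers_normal {T : Set (Subgroup G)} (hT : ∀ N ∈ T, N.Normal) :
    (centralizers T).Normal := by
  refine ⟨fun g hg a => mem_centralizers.2 fun N hN => ?_⟩
  have := hT N hN
  exact Subgroup.Normal.conj_mem inferInstance g (mem_centralizers.1 hg N hN) a

theorem centralizers_insert (T : Set (Subgroup G)) (N : Subgroup G) :
    centralizers (insert N T) = Subgroup.centralizer (N : Set G) ⊓ centralizers T := by
  rw [centralizers, iInf_insert, centralizers]

theorem exists_centralizer_le_ker {L : Type u} [Group L] [Finite L] (hL : IsMonolithic L)
    (hna : HasNonabelianSocle L) {ψ : G →* L} (hψ : Function.Surjective ψ)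
    {T : Set (Subgroup G)} (hT : T.Finite) (hTn : ∀ N ∈ T, N.Normal)
    (hle : centralizers T ≤ ψ.ker) :
    ∃ N ∈ T, Subgroup.centralizer (N : Set G) ≤ ψ.ker := by
  induction T, hT using Set.Finite.induction_on with
  | empty =>
    exfalso
    obtain ⟨x, -, y, -, hxy⟩ := hna
    have h1 : ∀ x : L, x = 1 := fun x => by
      obtain ⟨a, rfl⟩ := hψ x
      exact hle (mem_centralizers.2 (by simp))
    exact hxy (by rw [h1 x, h1 y])
  | @insert N T _ _ ih =>
    have hTn' : ∀ M ∈ T, M.Normal := fun M hM => hTn M (Set.mem_insert_of_mem _ hM)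
    have hN := hTn N (Set.mem_insert _ _)
    rw [centralizers_insert] at hle
    rcases le_ker_or_le_ker_of_inf_le hL hna hψ inferInstance (centralizers_normal hTn') hle
      with h | h
    · exact ⟨N, Set.mem_insert _ _, h⟩
    · obtain ⟨M, hM, hM'⟩ := ih hTn' h
      exact ⟨M, Set.mem_insert_of_mem _ hM, hM'⟩

/-- A minimal normal subgroup inside this intersection would centralize itself. -/
theorem centralizers_isMinimalNormal_eq_bot [Finite G]
    (hG : ∀ N : Subgroup G, IsMinimalNormal N → ¬ IsAbelianSubgroup N) :
    centralizers {N : Subgroup G | IsMinimalNormal N} = ⊥ := by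
  by_contra hne
  obtain ⟨N, hN, hle⟩ := exists_isMinimalNormal_le
    (centralizers_normal fun _ (h : IsMinimalNormal _) => h.normal) hne
  exact hG N hN fun a ha b hb =>
    Subgroup.mem_centralizer_iff.1 (mem_centralizers.1 (hle hb) N hN) a ha

/-- A finite nontrivial group without abelian minimal normal subgroups has a monolithic quotient
`L` with non-abelian socle such that no epimorphism to `L` kills all minimal normal
subgroups. -/
theorem exists_monolithic_quotient [Finite G] [Nontrivial G]
    (hG : ∀ N : Subgroup G, IsMinimalNormal N → ¬ IsAbelianSubgroup N) :
    ∃ (C : Subgroup G) (_ : C.Normal), IsMonolithic (G ⧸ C) ∧ HasNonabelianSocle (G ⧸ C) ∧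
      ∀ ψ : G →* G ⧸ C, Function.Surjective ψ →
        ∃ N : Subgroup G, IsMinimalNormal N ∧ ¬ N ≤ ψ.ker := by
  have hcent : ∀ {N : Subgroup G}, IsMinimalNormal N →
      (Subgroup.centralizer (N : Set G)).Normal := fun {N} hN => by
    have := hN.normal
    infer_instance
  obtain ⟨N₀, hN₀, -⟩ := exists_isMinimalNormal_le (G := G) (K := ⊤) inferInstance
    bot_ne_top.symm
  let S : Set (Subgroup G) := {C | ∃ _ : C.Normal, IsMonolithic (G ⧸ C) ∧
    HasNonabelianSocle (G ⧸ C)}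
  have hmem : ∀ {N : Subgroup G}, IsMinimalNormal N → Subgroup.centralizer (N : Set G) ∈ S :=
    fun {N} hN => ⟨hcent hN, by
      have := hcent hN
      exact hN.isMonolithic_quotient_centralizer (hG N hN) rfl⟩
  -- Least order of `C` means that `L = G ⧸ C` is as large as possible.
  obtain ⟨C, ⟨hCn, hC1, hC2⟩, hCmin⟩ := Set.exists_min_image S (fun C => Nat.card C)
    (Set.toFinite S) ⟨_, hmem hN₀⟩
  refine ⟨C, hCn, hC1, hC2, fun ψ hψ => ?_⟩
  by_contra! hker
  obtain ⟨N, hN, h⟩ := exists_centralizer_le_ker hC1 hC2 hψ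
    (Set.toFinite {N : Subgroup G | IsMinimalNormal N}) (fun _ h => h.normal)
    (by rw [centralizers_isMinimalNormal_eq_bot hG]; exact bot_le)
  -- The centralizer of `N` lies in `ψ.ker`, which has the least order `|C|`, so the two coincide.
  -- Then `N ≤ ψ.ker` centralizes itself.
  have h2 : Nat.card C = Nat.card ψ.ker := by
    have h3 := C.card_mul_index
    have h4 := ψ.ker.card_mul_index
    rw [Subgroup.index_ker, MonoidHom.range_eq_top.2 hψ, Subgroup.card_top] at h4
    rw [Subgroup.index_eq_card, ← h4] at h3
    exact Nat.eq_of_mul_eq_mul_right Nat.card_pos h3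
  have h1 := hCmin _ (hmem hN)
  rw [h2] at h1
  have h3 := Subgroup.eq_of_le_of_card_ge h h1
  refine hG N hN fun a ha b hb => ?_
  have := hker N hN hb
  rw [← h3] at this
  exact Subgroup.mem_centralizer_iff.1 this a ha

end

/-! ### Epimorphisms to crown-based powers -/

section
variable {G L : Type u} [Group G] [Group L] {k : ℕ}

theorem circ_apply (a : L) (m : Fin k → socle L) (j : Fin k) :
    (circ a m : Fin k → L) j = a * m j := rfl

/-- The `j`-th coordinate of a homomorphism to a crown-based power. -/
def coord (φ : G →* crownPower L k) (j : Fin k) : G →* L :=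
  (Pi.evalMonoidHom (fun _ => L) j).comp ((crownPower L k).subtype.comp φ)

theorem coord_apply (φ : G →* crownPower L k) (j : Fin k) (g : G) :
    coord φ j g = (φ g : Fin k → L) j := rfl

theorem coord_mk_eq (φ : G →* crownPower L k) (i j : Fin k) (g : G) :
    (coord φ i g : L ⧸ socle L) = coord φ j g := (φ g).2 i j

theorem coord_surjective {φ : G →* crownPower L k} (hφ : Function.Surjective φ) (j : Fin k) :
    Function.Surjective (coord φ j) := fun l => by
  obtain ⟨g, hg⟩ := hφ ⟨fun _ => l, fun _ _ => rfl⟩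
  exact ⟨g, by rw [coord_apply, hg]⟩

/-- Below a minimal normal subgroup which survives in the `j`-th coordinate, all other
coordinates are trivial. -/
theorem coord_eq_one [Finite L] (hL : IsMonolithic L) (hna : HasNonabelianSocle L)
    {φ : G →* crownPower L k} (hφ : Function.Surjective φ) {N : Subgroup G}
    (hN : IsMinimalNormal N) {j : Fin k} (hNj : ¬ N ≤ (coord φ j).ker) {i : Fin k}
    (hij : i ≠ j) : N ≤ (coord φ i).ker := by
  have hNn := hN.normal
  obtain ⟨x, hx, y, hy, hxy⟩ := hna
  have hle : socle L ≤ N.map (coord φ j) :=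
    hL.socle_le (hNn.map _ (coord_surjective hφ j)) fun hb =>
      hNj ((Subgroup.map_eq_bot_iff _).1 hb)
  obtain ⟨a, ha, hax⟩ := hle hx
  -- As `b` is trivial in coordinate `i` and equals `y` in coordinate `j`, the commutator of `a` and
  -- `b` lies in `N` and in the kernel of coordinate `i`, but is nontrivial in coordinate `j`.
  obtain ⟨b, hb⟩ := hφ (circ 1 (Pi.mulSingle j ⟨y, hy⟩))
  have hbi : coord φ i b = 1 := by
    rw [coord_apply, hb, circ_apply, Pi.mulSingle_eq_of_ne hij]
    simp
  have hbj : coord φ j b = y := by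
    rw [coord_apply, hb, circ_apply, Pi.mulSingle_eq_same]
    simp
  refine hN.le_of_inf_ne_bot (MonoidHom.normal_ker _) fun hbot => hxy ?_
  have hmem : a * b * a⁻¹ * b⁻¹ ∈ (coord φ i).ker ⊓ N := by
    refine ⟨?_, ?_⟩
    · exact MonoidHom.mem_ker.2 (by simp [hbi])
    · have := N.mul_mem ha (hNn.conj_mem _ (N.inv_mem ha) b)
      simpa [mul_assoc] using this
  rw [hbot, Subgroup.mem_bot] at hmem
  have h := congrArg (coord φ j) hmem
  simp only [map_mul, map_inv, map_one, hax, hbj] at h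
  rwa [mul_inv_eq_one, mul_inv_eq_iff_eq_mul] at h

theorem exists_socle_nontrivial (hna : HasNonabelianSocle L) : Nontrivial (socle L) := by
  obtain ⟨x, hx, y, hy, hxy⟩ := hna
  refine ⟨⟨x, hx⟩, ⟨y, hy⟩, fun h => hxy ?_⟩
  rw [Subtype.mk.injEq] at h
  rw [h]

/-- Bounds `k`, so that a maximal one exists: `L_k` contains `(socle L)^k`, of order greater than
`k`. -/
theorem le_card_of_surjective [Finite G] [Finite L] (hna : HasNonabelianSocle L)
    {φ : G →* crownPower L k} (hφ : Function.Surjective φ) : k ≤ Nat.card G := by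
  have := exists_socle_nontrivial hna
  have h1 : Nat.card (Fin k → socle L) ≤ Nat.card (crownPower L k) := by
    refine Nat.card_le_card_of_injective (circ (1 : L)) fun m m' h => ?_
    funext j
    have := congrFun (congrArg Subtype.val h) j
    rw [circ_apply, circ_apply] at this
    exact Subtype.ext (by simpa using this)
  have h2 := Nat.card_le_card_of_surjective φ hφ
  rw [Nat.card_fun, Nat.card_fin] at h1
  have h3 : k < Nat.card (socle L) ^ k := Nat.lt_pow_self Finite.one_lt_card
  omega

/-- A homomorphism to a crown-based power, extended by another coordinate. -/
def consHom (φ : G →* crownPower L k) (ψ : G →* L)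
    (h : ∀ g j, (ψ g : L ⧸ socle L) = coord φ j g) : G →* crownPower L (k + 1) :=
  MonoidHom.codRestrict
    (MonoidHom.mk' (fun g => (Fin.cons (ψ g) (φ g : Fin k → L) : Fin (k + 1) → L))
      fun a b => by
        funext j
        refine Fin.cases ?_ (fun j => ?_) j <;> simp)
    (crownPower L (k + 1)) fun g i j => by
      refine Fin.cases ?_ (fun i => ?_) i <;> refine Fin.cases ?_ (fun j => ?_) j
      · rfl
      · exact h g j
      · exact (h g i).symm
      · exact (φ g).2 i j

theorem consHom_apply (φ : G →* crownPower L k) (ψ : G →* L)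
    (h : ∀ g j, (ψ g : L ⧸ socle L) = coord φ j g) (g : G) :
    (consHom φ ψ h g : Fin (k + 1) → L) = Fin.cons (ψ g) (φ g : Fin k → L) := rfl

theorem exists_maximal_crownPower [Finite G] [Finite L] (hna : HasNonabelianSocle L)
    {ψ : G →* L} (hψ : Function.Surjective ψ) :
    ∃ k : ℕ, 1 ≤ k ∧ (∃ φ : G →* crownPower L k, Function.Surjective φ) ∧
      ¬ ∃ φ : G →* crownPower L (k + 1), Function.Surjective φ := by
  classical
  let P : ℕ → Prop := fun k => ∃ φ : G →* crownPower L k, Function.Surjective φ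
  have h1 : P 1 := by
    refine ⟨MonoidHom.codRestrict (MonoidHom.mk' (fun g _ => ψ g) fun a b => by
      funext; simp) (crownPower L 1) fun g i j => rfl, fun l => ?_⟩
    obtain ⟨g, hg⟩ := hψ ((l : Fin 1 → L) 0)
    refine ⟨g, Subtype.ext (funext fun j => ?_)⟩
    rw [Subsingleton.elim j 0]
    exact hg
  have hb : ∀ k, P k → k ≤ Nat.card G := fun k ⟨φ, hφ⟩ => le_card_of_surjective hna hφ
  refine ⟨Nat.findGreatest P (Nat.card G), Nat.le_findGreatest (hb 1 h1) h1,
    Nat.findGreatest_spec (hb 1 h1) h1, fun h => ?_⟩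
  have := Nat.le_findGreatest (P := P) (hb _ h) h
  omega

/-- Properties of a normal subgroup `U` and an epimorphism to a crown-based power `L_k` which
make the group a fibre product of its quotient by `U` and `L_k`. -/
structure IsCrownComplement (φ : G →* crownPower L k) (U : Subgroup G) : Prop where
  normal : U.Normal
  ne_bot : U ≠ ⊥
  inf_ker : U ⊓ φ.ker = ⊥
  exists_circ : ∀ m : Fin k → socle L, ∃ u ∈ U, φ u = circ 1 m
  mem_socle : ∀ u ∈ U, ∀ j, coord φ j u ∈ socle L
  eq_top : ∀ H : Subgroup G, H ⊔ U = ⊤ → H ⊔ φ.ker = ⊤ → H = ⊤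

/-- `H` normalizes `H ⊓ U`, while `R` centralizes `U`. -/
theorem normal_inf_of_sup_eq_top {H U R : Subgroup G} (hU : U.Normal) (hR : R.Normal)
    (hUR : U ⊓ R = ⊥) (h : H ⊔ R = ⊤) : (H ⊓ U).Normal := by
  rw [← Subgroup.normalizer_eq_top_iff, eq_top_iff, ← h, sup_le_iff]
  constructor
  · intro h hh
    rw [Subgroup.mem_normalizer_iff]
    intro g
    rw [Subgroup.mem_inf, Subgroup.mem_inf, ← hU.mem_comm_iff, inv_mul_cancel_left,
      H.mul_mem_cancel_right (H.inv_mem hh), H.mul_mem_cancel_left hh]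
  · intro r hr
    rw [Subgroup.mem_normalizer_iff]
    intro g
    have key : ∀ g ∈ U, r * g * r⁻¹ = g := fun g hg => by
      rw [← commute_of_inf_eq_bot hU hR hUR hg hr, mul_inv_cancel_right]
    constructor
    · intro hg
      rwa [key g hg.2]
    · intro hg
      have h2 : g ∈ U := by
        have := hU.conj_mem _ hg.2 r⁻¹
        simpa [mul_assoc] using this
      rwa [key g h2] at hg

/-- If `H` supplements `U`, a homomorphism which is trivial on `H ∩ U` and onto on `H` induces
one that is trivial on `U`. -/
theorem exists_hom_of_sup_eq_top {U H : Subgroup G} (hU : U.Normal) (hHU : H ⊔ U = ⊤)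
    (ψ : G →* L) (hψ : H ⊓ U ≤ ψ.ker) :
    ∃ ψ' : G →* L, (∀ h ∈ H, ψ' h = ψ h) ∧ ∀ u ∈ U, ψ' u = 1 := by
  let π : H →* G ⧸ U := (QuotientGroup.mk' U).comp H.subtype
  have hπ : Function.Surjective π := fun z => by
    obtain ⟨g, rfl⟩ := QuotientGroup.mk'_surjective U z
    obtain ⟨h, hh, hgh⟩ := exists_mem_of_sup_eq_top hHU g
    exact ⟨⟨h, hh⟩, (QuotientGroup.eq.2 hgh).symm⟩
  have hker : π.ker ≤ (ψ.comp H.subtype).ker := fun h hh => by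
    have h1 : (h : G) ∈ U := (QuotientGroup.eq_one_iff _).1 hh
    exact hψ ⟨h.2, h1⟩
  refine ⟨(MonoidHom.liftOfSurjective π hπ ⟨ψ.comp H.subtype, hker⟩).comp
    (QuotientGroup.mk' U), fun h hh => ?_, fun u hu => ?_⟩
  · exact MonoidHom.liftOfRightInverse_comp_apply π _ (Function.rightInverse_surjInv hπ)
      ⟨ψ.comp H.subtype, hker⟩ ⟨h, hh⟩
  · rw [MonoidHom.comp_apply, QuotientGroup.mk'_apply, (QuotientGroup.eq_one_iff u).2 hu,
      map_one]

/-- The new coordinate is independent of the old ones: `N` adjusts `ψ` by any socle element, and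
`U`, invisible to `ψ`, undoes the effect on `φ`. -/
theorem consHom_surjective [Finite L] (hL : IsMonolithic L) {φ : G →* crownPower L k}
    (hφ : Function.Surjective φ) (hk : 1 ≤ k) {U N : Subgroup G} (hN : N.Normal)
    (hU : ∀ m : Fin k → socle L, ∃ u ∈ U, φ u = circ 1 m) {ψ : G →* L}
    (hψ : Function.Surjective ψ) (hψU : ∀ u ∈ U, ψ u = 1) (hψN : ¬ N ≤ ψ.ker)
    (h : ∀ g j, (ψ g : L ⧸ socle L) = coord φ j g) :
    Function.Surjective (consHom φ ψ h) := by
  intro l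
  let i₀ : Fin k := ⟨0, hk⟩
  obtain ⟨g, hg⟩ := hφ ⟨fun j => (l : Fin (k + 1) → L) j.succ, fun i j => l.2 i.succ j.succ⟩
  have hs : (ψ g)⁻¹ * (l : Fin (k + 1) → L) 0 ∈ socle L := by
    rw [← QuotientGroup.eq, h g i₀, coord_apply, hg]
    exact l.2 i₀.succ 0
  have hle : socle L ≤ N.map ψ :=
    hL.socle_le (hN.map ψ hψ) fun hb => hψN ((Subgroup.map_eq_bot_iff _).1 hb)
  obtain ⟨n, -, hns⟩ := hle hs
  have hns' : ∀ j, coord φ j n ∈ socle L := fun j => by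
    rw [← hns, ← QuotientGroup.eq_one_iff, h n j, QuotientGroup.eq_one_iff] at hs
    exact hs
  obtain ⟨v, hv, hvφ⟩ := hU fun j => ⟨coord φ j n, hns' j⟩
  have hvn : φ v = φ n := by
    rw [hvφ]
    ext j
    rw [circ_apply, one_mul]
    rfl
  refine ⟨g * (n * v⁻¹), Subtype.ext ?_⟩
  rw [consHom_apply]
  funext j
  refine Fin.cases ?_ (fun j => ?_) j
  · rw [Fin.cons_zero, map_mul, map_mul, map_inv, hψU v hv, hns]
    simp
  · rw [Fin.cons_succ, map_mul, map_mul, map_inv, hvn, mul_inv_cancel, mul_one, hg]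

/-- `U` is the join of minimal normal subgroups `N j`, one surviving in each coordinate. A proper
`H` supplementing both `U` and `φ.ker` would yield an epimorphism to `L` trivial on `U`, hence a
further coordinate, against the maximality of `k`. -/
theorem exists_isCrownComplement [Finite G] [Finite L] (hL : IsMonolithic L)
    (hna : HasNonabelianSocle L)
    (hG : ∀ N : Subgroup G, IsMinimalNormal N → ¬ IsAbelianSubgroup N)
    (hs : ∀ ψ : G →* L, Function.Surjective ψ →
      ∃ N : Subgroup G, IsMinimalNormal N ∧ ¬ N ≤ ψ.ker)
    (hk : 1 ≤ k) {φ : G →* crownPower L k} (hφ : Function.Surjective φ)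
    (hmax : ¬ ∃ φ : G →* crownPower L (k + 1), Function.Surjective φ) :
    ∃ U : Subgroup G, IsCrownComplement φ U := by
  choose N hN hNker using fun j => hs _ (coord_surjective hφ j)
  have hNn := fun j => (hN j).normal
  have hone : ∀ {i j}, i ≠ j → ∀ n ∈ N j, coord φ i n = 1 := fun {i j} hij n hn =>
    coord_eq_one hL hna hφ (hN j) (hNker j) hij hn
  have hsoc : ∀ j, (N j).map (coord φ j) = socle L := by
    intro j
    have hle : socle L ≤ (N j).map (coord φ j) :=
      hL.socle_le ((hNn j).map _ (coord_surjective hφ j)) fun hb =>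
        hNker j ((Subgroup.map_eq_bot_iff _).1 hb)
    refine le_antisymm (Subgroup.map_le_iff_le_comap.2 ?_) hle
    refine (hN j).le_of_inf_ne_bot inferInstance fun hbot => ?_
    refine hL.isMinimalNormal_socle.ne_bot (eq_bot_iff.2 fun s hs' => ?_)
    obtain ⟨n, hn, rfl⟩ := hle hs'
    have : n ∈ (socle L).comap (coord φ j) ⊓ N j := ⟨hs', hn⟩
    rw [hbot, Subgroup.mem_bot] at this
    rw [this, map_one]
    exact Subgroup.one_mem _
  let U : Subgroup G := ⨆ j, N j
  have hNU : ∀ j, N j ≤ U := le_iSup N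
  have hU : U.Normal := Subgroup.iSup_normal N
  have hcirc : ∀ m : Fin k → socle L, ∃ u ∈ U, φ u = circ 1 m := by
    intro m
    have : (fun j => (m j : L)) ∈ (U.map φ).map (crownPower L k).subtype := by
      refine Subgroup.pi_mem_of_mulSingle_mem _ fun j => ?_
      obtain ⟨n, hn, hnm⟩ := (hsoc j).ge (m j).2
      refine ⟨φ n, ⟨n, hNU j hn, rfl⟩, ?_⟩
      funext i
      rcases eq_or_ne i j with rfl | hij
      · rw [Pi.mulSingle_eq_same]
        exact hnm
      · rw [Pi.mulSingle_eq_of_ne hij]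
        exact hone hij n hn
    obtain ⟨_, ⟨u, hu, rfl⟩, h⟩ := this
    refine ⟨u, hu, Subtype.ext (h.trans (funext fun j => ?_))⟩
    rw [circ_apply, one_mul]
  have hUsoc : ∀ u ∈ U, ∀ j, coord φ j u ∈ socle L := by
    intro u hu i
    have : U ≤ (socle L).comap (coord φ i) := iSup_le fun j n hn => by
      rw [Subgroup.mem_comap]
      rcases eq_or_ne i j with rfl | hij
      · exact (hsoc i).le ⟨n, hn, rfl⟩
      · rw [hone hij n hn]
        exact Subgroup.one_mem _
    exact this hu
  -- A minimal normal subgroup inside `U ⊓ φ.ker` meets every `N j` trivially, so it is centralized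
  -- by `U`, which contains it; it would be abelian.
  have hUR : U ⊓ φ.ker = ⊥ := by
    by_contra hne
    obtain ⟨M, hM, hle⟩ := exists_isMinimalNormal_le inferInstance hne
    refine hG M hM fun a ha b hb => ?_
    have : U ≤ Subgroup.centralizer {a} := iSup_le fun j n hn => by
      have hbot : M ⊓ N j = ⊥ := by
        by_contra h
        refine hNker j fun x hx => ?_
        have hx' : φ x = 1 := (hle ((hN j).le_of_inf_ne_bot hM.normal h hx)).2
        rw [MonoidHom.mem_ker, coord_apply, hx']
        rfl
      rw [Subgroup.mem_centralizer_singleton_iff]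
      exact (commute_of_inf_eq_bot hM.normal (hNn j) hbot ha hn).symm
    have hb' := this (hle hb).1
    exact (Subgroup.mem_centralizer_singleton_iff.1 hb').symm
  refine ⟨U, hU, ?_, hUR, hcirc, hUsoc, fun H hHU hHR => ?_⟩
  · intro hbot
    exact (hN ⟨0, hk⟩).ne_bot (eq_bot_iff.2 (hbot ▸ hNU _))
  by_contra hH
  obtain ⟨j, hj⟩ : ∃ j, ¬ N j ≤ H := by
    by_contra! hc
    exact hH (by rwa [sup_eq_left.2 (iSup_le hc)] at hHU)
  have hA := normal_inf_of_sup_eq_top hU (MonoidHom.normal_ker φ) hUR hHR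
  -- The normal subgroup `H ⊓ U` misses `N j`, so its image in coordinate `j` centralizes the socle
  -- and is trivial.
  have hA1 : H ⊓ U ≤ (coord φ j).ker := by
    have hbot : (H ⊓ U) ⊓ N j = ⊥ := by
      by_contra h
      exact hj (((hN j).le_of_inf_ne_bot hA h).trans inf_le_left)
    rw [← Subgroup.map_eq_bot_iff]
    refine hL.eq_bot_of_commute hna (hA.map _ (coord_surjective hφ j)) ?_
    rintro _ ⟨a, ha, rfl⟩ s hs'
    rw [← hsoc j] at hs'
    obtain ⟨n, hn, rfl⟩ := hs'
    rw [← map_mul, commute_of_inf_eq_bot hA (hNn j) hbot ha hn, map_mul]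
  obtain ⟨ψ, hψH, hψU⟩ := exists_hom_of_sup_eq_top hU hHU (coord φ j) hA1
  have hψ : Function.Surjective ψ := fun l => by
    obtain ⟨g, rfl⟩ := coord_surjective hφ j l
    obtain ⟨h, hh, hgh⟩ := exists_mem_of_sup_eq_top hHR g
    refine ⟨h, ?_⟩
    rw [hψH h hh, coord_apply, coord_apply, MonoidHom.eq_iff φ |>.2 hgh]
  obtain ⟨M, hM, hMψ⟩ := hs ψ hψ
  have hcomp : ∀ g i, (ψ g : L ⧸ socle L) = coord φ i g := by
    intro g i
    obtain ⟨h, hh, hgh⟩ := exists_mem_of_sup_eq_top hHU g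
    have h1 := hψU _ hgh
    rw [map_mul, map_inv, inv_mul_eq_one, hψH h hh] at h1
    have h2 := hUsoc _ hgh i
    rw [map_mul, map_inv, ← QuotientGroup.eq] at h2
    rw [h1, h2, coord_mk_eq φ j i]
  exact hmax ⟨_, consHom_surjective hL hφ hk hM.normal hcirc hψ hψU hMψ hcomp⟩

end

/-! ### Lifting paths from a crown-based power -/

section
variable {G L : Type u} [Group G] [Group L] {k d : ℕ}

/-- The projection of a crown-based power to the quotient by the socle. -/
def base (i : Fin k) : crownPower L k →* L ⧸ socle L :=
  (QuotientGroup.mk' (socle L)).comp ((Pi.evalMonoidHom (fun _ => L) i).comp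
    (crownPower L k).subtype)

theorem base_apply (i j : Fin k) (c : crownPower L k) :
    base i c = ((c : Fin k → L) j : L ⧸ socle L) := c.2 i j

theorem base_circ (i : Fin k) (a : L) (m : Fin k → socle L) :
    base i (circ a m) = (a : L ⧸ socle L) := by
  rw [base_apply i i, circ_apply, QuotientGroup.mk_mul_of_mem a (m i).2]

theorem exists_eq_circ {i : Fin k} {c : crownPower L k} {a : L}
    (h : base i c = (a : L ⧸ socle L)) : ∃ m, c = circ a m := by
  refine ⟨fun j => ⟨a⁻¹ * (c : Fin k → L) j, ?_⟩, Subtype.ext (funext fun j => ?_)⟩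
  · rw [← QuotientGroup.eq, ← h, base_apply i j]
  · rw [circ_apply, mul_inv_cancel_left]

/-- Edges need distinct ends. A tuple with all entries equal would generate a cyclic group. -/
theorem Generates.exists_ne (hna : HasNonabelianSocle L) (hk : 1 ≤ k)
    {c : Fin d → crownPower L k} (hc : Generates c) (i : Fin d) : ∃ j, c i ≠ c j := by
  by_contra! h
  have h1 : Subgroup.closure (Set.range c) ≤ Subgroup.zpowers (c i) := by
    rw [Subgroup.closure_le]
    rintro _ ⟨j, rfl⟩
    rw [← h j]
    exact Subgroup.mem_zpowers _
  rw [show Subgroup.closure _ = ⊤ from hc] at h1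
  obtain ⟨x, hx, y, hy, hxy⟩ := hna
  obtain ⟨r, hr⟩ := Subgroup.mem_zpowers_iff.1
    (h1 (Subgroup.mem_top (circ (1 : L) fun _ : Fin k => ⟨x, hx⟩)))
  obtain ⟨s, hs⟩ := Subgroup.mem_zpowers_iff.1
    (h1 (Subgroup.mem_top (circ (1 : L) fun _ : Fin k => ⟨y, hy⟩)))
  have h2 := (Commute.refl (c i)).zpow_zpow r s
  rw [hr, hs] at h2
  have h3 := congrFun (congrArg Subtype.val h2.eq) ⟨0, hk⟩
  simp only [Subgroup.coe_mul, Pi.mul_apply, circ_apply, one_mul] at h3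
  exact hxy h3

theorem Generates.update_inv_mul {p : Fin d → G} (hp : Generates p) {i j : Fin d}
    (hij : i ≠ j) : Generates (Function.update p j ((p i)⁻¹ * p j)) := by
  refine hp.of_mem_closure fun u => ?_
  have hmem : ∀ u, Function.update p j ((p i)⁻¹ * p j) u ∈
      Subgroup.closure (Set.range (Function.update p j ((p i)⁻¹ * p j))) :=
    fun u => Subgroup.subset_closure ⟨u, rfl⟩
  rcases eq_or_ne u j with rfl | hu
  · have h1 := hmem u
    have h2 := hmem i
    rw [Function.update_self] at h1
    rw [Function.update_of_ne hij] at h2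
    simpa using Subgroup.mul_mem _ h2 h1
  · have := hmem u
    rwa [Function.update_of_ne hu] at this

theorem Generates.update_inv_mul_left {p : Fin d → G} (hp : Generates p) {i j : Fin d}
    (hij : i ≠ j) : Generates (Function.update p j ((p j)⁻¹ * p i)) := by
  refine (hp.update_inv_mul hij).of_mem_closure fun u => ?_
  have hmem : ∀ u, Function.update p j ((p j)⁻¹ * p i) u ∈
      Subgroup.closure (Set.range (Function.update p j ((p j)⁻¹ * p i))) :=
    fun u => Subgroup.subset_closure ⟨u, rfl⟩
  have := hmem u
  rcases eq_or_ne u j with rfl | hu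
  · rw [Function.update_self] at this ⊢
    simpa using Subgroup.inv_mem _ this
  · rwa [Function.update_of_ne hu] at this ⊢

theorem Generates.update_update {p : Fin d → G} (hp : Generates p) {i j : Fin d}
    (hij : i ≠ j) :
    Generates (Function.update (Function.update p j ((p j)⁻¹ * p i)) i (p j)) := by
  have h := (hp.perm (Equiv.swap i j)).update_inv_mul hij
  convert h using 1
  funext u
  rcases eq_or_ne u j with rfl | hu
  · simp [hij.symm]
  · rcases eq_or_ne u i with rfl | hu'
    · simp [hu]
    · simp [hu, hu', Equiv.swap_apply_of_ne_of_ne hu' hu]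

variable {φ : G →* crownPower L k} {U : Subgroup G}

theorem IsCrownComplement.base_eq (h : IsCrownComplement φ U) (i : Fin k) {x y : G}
    (hxy : (x : G ⧸ U) = y) : base i (φ x) = base i (φ y) := by
  have h1 := h.mem_socle _ (QuotientGroup.eq.1 hxy) i
  rwa [← QuotientGroup.eq_one_iff, map_mul, map_inv, QuotientGroup.mk_mul,
    QuotientGroup.mk_inv, inv_mul_eq_one] at h1

theorem IsCrownComplement.eq (h : IsCrownComplement φ U) {x y : G} (hxy : (x : G ⧸ U) = y)
    (hφ : φ x = φ y) : x = y := by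
  have : x⁻¹ * y ∈ U ⊓ φ.ker :=
    ⟨QuotientGroup.eq.1 hxy, MonoidHom.mem_ker.2 (by rw [map_mul, map_inv, hφ, inv_mul_cancel])⟩
  rw [h.inf_ker, Subgroup.mem_bot] at this
  exact inv_mul_eq_one.1 this

/-- The existence half of the fibre product: `φ` maps `U` onto `(socle L)^k`, so `g` can be
corrected inside its coset. Uniqueness is `IsCrownComplement.eq`. -/
theorem IsCrownComplement.exists_lift (h : IsCrownComplement φ U) (i : Fin k) {g : G}
    {c : crownPower L k} (hc : base i c = base i (φ g)) :
    ∃ x : G, (x : G ⧸ U) = g ∧ φ x = c := by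
  obtain ⟨m, hm⟩ := exists_eq_circ (i := i) (c := (φ g)⁻¹ * c) (a := 1) (by
    rw [map_mul, map_inv, hc, inv_mul_cancel, QuotientGroup.mk_one])
  obtain ⟨u, hu, huφ⟩ := h.exists_circ m
  exact ⟨g * u, QuotientGroup.mk_mul_of_mem g hu, by rw [map_mul, huφ, ← hm, mul_inv_cancel_left]⟩

theorem IsCrownComplement.generates (h : IsCrownComplement φ U) {p t : Fin d → G}
    (hp : Generates p) (ht : ∀ u, (t u : G ⧸ U) = p u) (hφ : Generates fun u => φ (t u)) :
    Generates t := by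
  refine h.eq_top _ (sup_eq_top_of_lift (p := p) (q := t) ?_
    (fun u => QuotientGroup.eq.1 (ht u).symm) le_rfl) ?_
  · rw [show Subgroup.closure _ = ⊤ from hp, top_sup_eq]
  · have h1 : (Subgroup.closure (Set.range t)).map φ = ⊤ := by
      rw [MonoidHom.map_closure, ← Set.range_comp]
      exact hφ
    rw [← Subgroup.comap_map_eq, h1, Subgroup.comap_top]

theorem IsCrownComplement.exists_generates (h : IsCrownComplement φ U) (i : Fin k)
    {p : Fin d → G} (hp : Generates p) {c : Fin d → crownPower L k} (hc : Generates c)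
    (hpc : ∀ u, base i (c u) = base i (φ (p u))) :
    ∃ t : Fin d → G, Generates t ∧ (∀ u, (t u : G ⧸ U) = p u) ∧ ∀ u, φ (t u) = c u := by
  choose t ht1 ht2 using fun u => h.exists_lift i (hpc u)
  exact ⟨t, h.generates hp ht1 (by simpa only [ht2] using hc), ht1, ht2⟩

/-- One vertex of the local graph may lie over two different indices. Here `c l` and `c l'` agree
modulo the socle, so the `l'`-th entry can be lifted from `(g l')⁻¹ * g l` and `(c l)⁻¹ * c l'`,
both trivial modulo the socle. With this entry fixed, the `l`-th entry may be either `x` or `x'`, so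
both are linked to it. -/
theorem IsCrownComplement.linked_of_ne (h : IsCrownComplement φ U) (i : Fin k)
    {g : Fin d → G} (hg : Generates g) {c : Fin d → crownPower L k} (hc : Generates c)
    (hgc : ∀ u, base i (c u) = base i (φ (g u))) {l l' : Fin d} (hl : l ≠ l') {x x' : G}
    (hx : φ x = c l) (hx' : φ x' = c l) (hxl : (x : G ⧸ U) = g l) (hxl' : (x' : G ⧸ U) = g l') :
    Linked d x x' := by
  have hUn := h.normal
  have hb : base i (c l) = base i (c l') := by
    rw [hgc l', ← hx', h.base_eq i hxl']
  obtain ⟨t, ht, ht1, ht2⟩ := h.exists_generates i (hg.update_inv_mul_left hl)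
    (hc.update_inv_mul hl) (fun u => by
      rcases eq_or_ne u l' with rfl | hu
      · rw [Function.update_self, Function.update_self, map_mul, map_inv, hb, map_mul, map_inv,
          map_mul, map_inv, ← hgc, ← hgc, hb]
      · rw [Function.update_of_ne hu, Function.update_of_ne hu, hgc])
  have htl : t l = x := h.eq (by rw [ht1, Function.update_of_ne hl, hxl])
    (by rw [ht2, Function.update_of_ne hl, hx])
  have ht' : Generates (Function.update t l x') := by
    refine h.generates (hg.update_update hl) (fun u => ?_) ?_
    · rcases eq_or_ne u l with rfl | hu
      · rw [Function.update_self, Function.update_self, hxl']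
      · rw [Function.update_of_ne hu, Function.update_of_ne hu, ht1]
    · have e : (fun u => φ (t u)) = Function.update c l' ((c l)⁻¹ * c l') := funext ht2
      convert (e ▸ hc.update_inv_mul hl : Generates fun u => φ (t u)) using 2 with u
      rcases eq_or_ne u l with rfl | hu
      · rw [Function.update_self, htl, hx, hx']
      · rw [Function.update_of_ne hu]
  have h1 := ht.linked l l'
  have h2 := ht'.linked l l'
  rw [Function.update_self, Function.update_of_ne hl.symm] at h2
  rw [htl] at h1
  exact h1.trans h2.symm

/-- Two elements with the same image in the crown-based power are linked if each of them is
congruent to an entry of a given generating tuple. -/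
theorem IsCrownComplement.linked (h : IsCrownComplement φ U) (i : Fin k)
    {g : Fin d → G} (hg : Generates g) {c : Fin d → crownPower L k} (hc : Generates c)
    (hgc : ∀ u, base i (c u) = base i (φ (g u))) {s l l' : Fin d} {x x' : G}
    (hx : φ x = c s) (hx' : φ x' = c s) (hxl : (x : G ⧸ U) = g l)
    (hxl' : (x' : G ⧸ U) = g l') : Linked d x x' := by
  rcases eq_or_ne l l' with rfl | hl
  · rw [h.eq (hxl.trans hxl'.symm) (hx.trans hx'.symm)]
    exact Linked.refl _
  · have hb : base i (c s) = base i (c l) := by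
      rw [hgc l, ← hx, h.base_eq i hxl]
    refine h.linked_of_ne i hg (hc.perm (Equiv.swap s l)) (fun u => ?_) hl
      (by simpa using hx) (by simpa using hx') hxl hxl'
    rcases eq_or_ne u s with rfl | hu
    · rw [Equiv.swap_apply_left, ← hb, hgc]
    · rcases eq_or_ne u l with rfl | hu'
      · rw [Equiv.swap_apply_right, hb, hgc]
      · rw [Equiv.swap_apply_of_ne_of_ne hu hu', hgc]

/-- Each edge lifts to a generating tuple over `g`. Consecutive edges may use different indices at
their common vertex, and `IsCrownComplement.linked` joins the two lifts of it. -/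
theorem IsCrownComplement.linked_of_reachable (h : IsCrownComplement φ U) (i : Fin k)
    {g : Fin d → G} (hg : Generates g) {v w : (localGraph (fun u => coord φ i (g u)) k).support}
    (hvw : (localRankGraph (fun u => coord φ i (g u)) k).Reachable v w) {l l' : Fin d}
    {x x' : G} (hx : φ x = v) (hx' : φ x' = w) (hxl : (x : G ⧸ U) = g l)
    (hxl' : (x' : G ⧸ U) = g l') : Linked d x x' := by
  have hb : ∀ m : Fin d → Fin k → socle L, ∀ u,
      base i (circ (coord φ i (g u)) (m u)) = base i (φ (g u)) := fun m u => by
    rw [base_circ]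
    rfl
  obtain ⟨p⟩ := hvw
  induction p generalizing x l with
  | nil =>
    rename_i v
    obtain ⟨w, -, s, -, -, m, hv, -, hgen⟩ := (SimpleGraph.mem_support _).1 v.2
    exact h.linked i hg hgen (hb m) (hx.trans hv) (hx'.trans hv) hxl hxl'
  | cons hadj _ ih =>
    obtain ⟨-, s, r, -, m, hv, hw, hgen⟩ := hadj
    obtain ⟨t, ht, ht1, ht2⟩ := h.exists_generates i hg hgen (hb m)
    have h1 := h.linked i hg hgen (hb m) (hx.trans hv) (ht2 s) hxl (ht1 s)
    exact (h1.trans (ht.linked s r)).trans (ih ((ht2 r).trans hw.symm) hx' (ht1 r))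

theorem map_mem_support_localGraph (hna : HasNonabelianSocle L) (hk : 1 ≤ k)
    (hφ : Function.Surjective φ) (i : Fin k) {a : Fin d → L} {q : Fin d → G} (hq : Generates q)
    (hqa : ∀ u, base i (φ (q u)) = (a u : L ⧸ socle L)) (s : Fin d) :
    φ (q s) ∈ (localGraph a k).support := by
  choose m hm using fun u => exists_eq_circ (hqa u)
  have hgen := hq.map φ hφ
  obtain ⟨r, hr⟩ := hgen.exists_ne hna hk s
  refine (SimpleGraph.mem_support _).2 ⟨φ (q r), hr, s, r, ?_, m, hm s, hm r, ?_⟩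
  · rintro rfl
    exact hr rfl
  · simp only [← hm]
    exact hgen

/-- If the crown-based power is locally connected, then generating elements which are congruent
modulo `U` are linked. -/
theorem IsCrownComplement.linked_of_mk_eq [Finite G] (h : IsCrownComplement φ U)
    (hna : HasNonabelianSocle L) (hk : 1 ≤ k) (hφ : Function.Surjective φ)
    (hloc : LocallyConnected L k d) {g : Fin d → G} (hg : Generates g) (s : Fin d) {y : G}
    (hy : CoOccur d y y) (hgy : (g s : G ⧸ U) = y) : Linked d (g s) y := by
  have hUn := h.normal
  let i : Fin k := ⟨0, hk⟩
  have hgU : Subgroup.closure (Set.range g) ⊔ U = ⊤ := by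
    rw [show Subgroup.closure _ = ⊤ from hg, top_sup_eq]
  obtain ⟨p, hp, hyp, -⟩ := hy
  have hupd : ∀ u, (Function.update g s y u : G ⧸ U) = g u := fun u => by
    rcases eq_or_ne u s with rfl | hu
    · rw [Function.update_self, hgy]
    · rw [Function.update_of_ne hu]
  -- Completing `y` to a generating tuple congruent to `g` modulo `U` makes both tuples lie over the
  -- same generators of `L`.
  obtain ⟨q, hq, hqs, hqU⟩ := hp.exists_lift_of_mem_range (K := U)
    (p' := Function.update g s y)
    (sup_eq_top_of_lift hgU (fun u => QuotientGroup.eq.1 (hupd u).symm) le_rfl) s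
    (by rwa [Function.update_self])
  rw [Function.update_self] at hqs
  have hqg : ∀ u, (q u : G ⧸ U) = g u := fun u => by
    rw [← hupd u]
    exact (QuotientGroup.eq.2 (hqU u)).symm
  have hga : ∀ u, base i (φ (g u)) = (coord φ i (g u) : L ⧸ socle L) := fun u => rfl
  have hqa : ∀ u, base i (φ (q u)) = (coord φ i (g u) : L ⧸ socle L) := fun u => by
    rw [h.base_eq i (hqg u), hga]
  obtain ⟨m₁, hm₁⟩ := exists_eq_circ (hga s)
  obtain ⟨m₂, hm₂⟩ := exists_eq_circ (hqa s)
  have hs₁ := map_mem_support_localGraph hna hk hφ i hg hga s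
  have hs₂ := map_mem_support_localGraph hna hk hφ i hq hqa s
  rw [hm₁] at hs₁
  rw [hm₂] at hs₂
  obtain ⟨m, hm, hreach⟩ := hloc (fun u => coord φ i (g u))
    (hg.map _ (coord_surjective hφ i)) s m₁ m₂ hs₁ hs₂
  -- The conjugating element lifts to `U`, so conjugation by it does not change classes modulo `U`.
  obtain ⟨v, hv, hvφ⟩ := h.exists_circ m
  have h1 : Linked d (g s) (v⁻¹ * q s * v⁻¹⁻¹) := by
    refine h.linked_of_reachable i hg hreach (l := s) (l' := s) hm₁ ?_ rfl ?_
    · simp only [map_mul, map_inv, inv_inv, hvφ, hm₂]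
    · have hv1 : (v : G ⧸ U) = 1 := (QuotientGroup.eq_one_iff v).2 hv
      simp [hv1, hqg]
  rw [← hqs]
  exact h1.trans (hq.linked_conj s v⁻¹).symm

end

/-! ### The connectivity theorem -/

/-- All epimorphic images of `G` which are non-abelian crown-based powers are `d`-locally
connected. -/
def CrownsLocallyConnected (G : Type u) [Group G] (d : ℕ) : Prop :=
  ∀ (L : Type u) [Group L] [Finite L], IsMonolithic L → HasNonabelianSocle L →
    ∀ k : ℕ, 1 ≤ k → (∃ φ : G →* crownPower L k, Function.Surjective φ) →
      LocallyConnected L k d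

theorem linked_of_linked_quotient {G : Type u} [Group G] [Finite G] {d : ℕ} (U : Subgroup G)
    [U.Normal] (hquot : ∀ x y : G ⧸ U, CoOccur d x x → CoOccur d y y → Linked d x y)
    (hU : ∀ x y : G, CoOccur d x x → CoOccur d y y → (x : G ⧸ U) = y → Linked d x y)
    {x y : G} (hx : CoOccur d x x) (hy : CoOccur d y y) : Linked d x y := by
  have hmk : ∀ {z : G}, CoOccur d z z → CoOccur d (z : G ⧸ U) z := by
    rintro z ⟨f, hf, ⟨j, rfl⟩, -⟩
    exact (hf.map (QuotientGroup.mk' U) (QuotientGroup.mk'_surjective U)).coOccur j j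
  obtain ⟨z, hz, hzy, hxz⟩ := exists_linked_of_linked_quotient U hx
    (hquot x y (hmk hx) (hmk hy))
  exact hxz.trans (hU z y hz hy hzy)

theorem linked_of_crownsLocallyConnected {d : ℕ} (hd : 2 ≤ d) (n : ℕ) :
    ∀ (G : Type u) [Group G] [Finite G], Nat.card G = n → CrownsLocallyConnected G d →
      ∀ x y : G, CoOccur d x x → CoOccur d y y → Linked d x y := by
  induction n using Nat.strong_induction_on with
  | _ n ih =>
  intro G _ _ hn hloc x y hx hy
  rcases subsingleton_or_nontrivial G with hG | hG
  · rw [Subsingleton.elim x y]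
    exact Linked.refl y
  have hquot : ∀ (U : Subgroup G) [U.Normal], U ≠ ⊥ →
      ∀ x y : G ⧸ U, CoOccur d x x → CoOccur d y y → Linked d x y := by
    intro U _ hU
    refine ih _ ?_ _ rfl fun L _ _ hL hna k hk ⟨φ, hφ⟩ => hloc L hL hna k hk
      ⟨φ.comp (QuotientGroup.mk' U), hφ.comp (QuotientGroup.mk'_surjective U)⟩
    have h1 := U.card_mul_index
    have h2 : 1 < Nat.card U := by
      rw [Subgroup.one_lt_card_iff_ne_bot]
      exact hU
    rw [Subgroup.index_eq_card] at h1
    have h3 : 0 < Nat.card (G ⧸ U) := Nat.card_pos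
    rw [← hn]
    nlinarith
  by_cases hab : ∃ N : Subgroup G, IsMinimalNormal N ∧ IsAbelianSubgroup N
  · obtain ⟨N, hN, hab⟩ := hab
    have hNn := hN.normal
    refine linked_of_linked_quotient N (hquot N hN.ne_bot) ?_ hx hy
    rintro _ y ⟨f, hf, ⟨j, rfl⟩, -⟩ hy hfy
    have := hf.linked_mul_of_abelian hd hN hab j ⟨_, QuotientGroup.eq.1 hfy⟩
      (by simpa using hy)
    simpa using this
  · push Not at hab
    obtain ⟨C, hC, hL, hna, hs⟩ := exists_monolithic_quotient hab
    obtain ⟨k, hk, ⟨φ, hφ⟩, hmax⟩ := exists_maximal_crownPower hna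
      (QuotientGroup.mk'_surjective C)
    obtain ⟨U, hU⟩ := exists_isCrownComplement hL hna hab hs hk hφ hmax
    have hUn := hU.normal
    refine linked_of_linked_quotient U (hquot U hU.ne_bot) ?_ hx hy
    rintro _ y ⟨f, hf, ⟨j, rfl⟩, -⟩ hy hfy
    exact hU.linked_of_mk_eq hna hk hφ (hloc _ hL hna k hk ⟨φ, hφ⟩) hf j hy hfy

/-! ### Generating tuples versus generating sets of cardinality `d` -/

theorem coOccur_of_adj {G : Type u} [Group G] {d : ℕ} {x y : G}
    (h : (generationGraph G d).Adj x y) : CoOccur d x y := by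
  obtain ⟨-, S, hS, hx, hy, hgen⟩ := h
  have hr : Set.range (fun i => ((S.equivFinOfCardEq hS).symm i : G)) = S := by
    rw [show (fun i => ((S.equivFinOfCardEq hS).symm i : G)) =
      Subtype.val ∘ (S.equivFinOfCardEq hS).symm from rfl, Set.range_comp,
      Equiv.range_eq_univ, Set.image_univ, Subtype.range_coe]
  exact ⟨_, by rw [Generates, hr]; exact hgen, by rw [hr]; exact hx, by rw [hr]; exact hy⟩

/-- Repeated entries leave fewer than `d` elements; the set is padded to size `d`, for which `G`
must be large enough. -/
theorem adj_of_coOccur {G : Type u} [Group G] [Finite G] {d : ℕ} (hd : d ≤ Nat.card G)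
    {x y : G} (hne : x ≠ y) (h : CoOccur d x y) : (generationGraph G d).Adj x y := by
  classical
  have := Fintype.ofFinite G
  obtain ⟨f, hf, hx, hy⟩ := h
  have hcard : (Finset.univ.image f).card ≤ d :=
    Finset.card_image_le.trans (by simp)
  obtain ⟨S, hS, -, hSd⟩ := Finset.exists_subsuperset_card_eq (Finset.subset_univ _) hcard
    (by rwa [Finset.card_univ, ← Nat.card_eq_fintype_card])
  have hsub : Set.range f ⊆ S := by
    rintro _ ⟨i, rfl⟩
    exact hS (Finset.mem_image_of_mem _ (Finset.mem_univ i))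
  exact ⟨hne, S, hSd, hsub hx, hsub hy,
    top_le_iff.1 ((show Subgroup.closure _ = ⊤ from hf).ge.trans (Subgroup.closure_mono hsub))⟩

theorem reachable_of_linked {G : Type u} [Group G] [Finite G] {d : ℕ} (hd : d ≤ Nat.card G)
    {x y : G} (hx : x ∈ (generationGraph G d).support) (h : Linked d x y) :
    ∃ hy : y ∈ (generationGraph G d).support, (rankGraph G d).Reachable ⟨x, hx⟩ ⟨y, hy⟩ := by
  induction h with
  | refl => exact ⟨hx, SimpleGraph.Reachable.refl _⟩
  | @tail y z _ hyz ih =>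
    obtain ⟨hy, hr⟩ := ih
    rcases eq_or_ne y z with rfl | hne
    · exact ⟨hy, hr⟩
    · have hadj := adj_of_coOccur hd hne hyz
      refine ⟨(SimpleGraph.mem_support _).2 ⟨y, hadj.symm⟩, hr.trans ?_⟩
      exact SimpleGraph.Adj.reachable (by exact hadj)

end RankGraph

theorem mainTheorem5 {G : Type u} [Group G] [Finite G] (d : ℕ)
    (hloc : ∀ (L : Type u) [Group L] [Finite L],
      RankGraph.IsMonolithic L → RankGraph.HasNonabelianSocle L →
      ∀ k : ℕ, 1 ≤ k →
        (∃ φ : G →* RankGraph.crownPower L k, Function.Surjective φ) →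
        RankGraph.LocallyConnected L k d) :
    (RankGraph.rankGraph G d).Preconnected := by
  -- A single edge already forces `2 ≤ d ≤ |G|`; without edges there are no vertices to join.
  have hcard : ∀ {x y : G}, (RankGraph.generationGraph G d).Adj x y →
      2 ≤ d ∧ d ≤ Nat.card G := by
    rintro x y ⟨hne, S, rfl, hx, hy, -⟩
    refine ⟨Finset.one_lt_card.2 ⟨x, hx, y, hy, hne⟩, ?_⟩
    have := Fintype.ofFinite G
    rw [Nat.card_eq_fintype_card]
    exact S.card_le_univ
  rintro ⟨x, hx⟩ ⟨y, hy⟩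
  obtain ⟨x', hxx'⟩ := (SimpleGraph.mem_support _).1 hx
  obtain ⟨y', hyy'⟩ := (SimpleGraph.mem_support _).1 hy
  obtain ⟨h2, hd⟩ := hcard hxx'
  have hself : ∀ {x y : G}, (RankGraph.generationGraph G d).Adj x y →
      RankGraph.CoOccur d x x := fun h => by
    obtain ⟨f, hf, hx, -⟩ := RankGraph.coOccur_of_adj h
    exact ⟨f, hf, hx, hx⟩
  exact (RankGraph.reachable_of_linked hd hx
    (RankGraph.linked_of_crownsLocallyConnected h2 _ G rfl hloc x y (hself hxx')
      (hself hyy'))).2
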